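/- Let $\mathcal P_2$ be the algebra of complex polynomials in two non-commuting indeterminates $X_1,X_2$, with the conjugate-linear involution $\mathcal J$ that reverses words and exchanges $X_1$ and $X_2$. Let $\phi:\mathcal P_2\to\mathbb C$ be a linear functional that is strictly positive, i.e. $\phi(\mathcal J(P)P)>0$ for every nonzero polynomial $P$ in $X_1$ alone, and put $K_\phi(k,j)=s_{k,j}=\phi(\mathcal J(X_1^k)X_1^j)$, $k,j\ge 0$. *Parameters.* There is exactly one family $\{\gamma_{k,j}\}_{0\le k<j}$ of complex numbers with $|\gamma_{k,j}|<1$ such that, with $d_{k,j}=(1-|\gamma_{k,j}|^2)^{1/2}$, $$s_{k,j}=s_{k,k}^{1/2}\,(U_{k,j})_{0,0}\,s_{j,j}^{1/2}\qquad(k<j),$$ where $U_{k,j}$ is the $(j-k+1)\times(j-k+1)$ matrix $$U_{k,j}=\prod_{m=k}^{j-1}\ \prod_{i=m+1}^{j}G_{i-m-1}(\gamma_{m,i})$$ (factors in increasing order of $m$, and of $i$ for each $m$) and $G_p(\gamma)$ is the identity matrix except for the block $\begin{bmatrix}\gamma&d\\ d&-\overline\gamma\end{bmatrix}$, $d=(1-|\gamma|^2)^{1/2}$,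 in rows and columns $p,p+1$ (numbered from $0$). *Polynomials.* Let $\varphi_0(X,l)=\varphi_0^\sharp(X,l)=s_{l,l}^{-1/2}$ and, for $n\ge1$, $l\ge0$, $$\varphi_n(X,l)=\tfrac1{d_{l,n+l}}\bigl(X\varphi_{n-1}(X,l+1)-\gamma_{l,n+l}\varphi^\sharp_{n-1}(X,l)\bigr),\qquad \varphi_n^\sharp(X,l)=\tfrac1{d_{l,n+l}}\bigl(-\overline{\gamma}_{l,n+l}X\varphi_{n-1}(X,l+1)+\varphi^\sharp_{n-1}(X,l)\bigr).$$ For every $l$, $\{\varphi_n(X,l)\}_{n\ge0}$ is the family of orthonormal polynomials ($\deg\varphi_n(X,l)=n$, positive leading coefficient) of the shifted kernel $(\alpha,\beta)\mapsto s_{\alpha+l,\beta+l}$. *Arrays.* Let $\mathcal R_1$ be the algebra of lower triangular arrays $[a_{k,j}]_{k,j\ge0}$ of complex numbers ($a_{k,j}=0$ for $k<j$) with entrywise addition and $(ab)_{k,j}=\sum_l a_{k,l}b_{l,j}$, and let $\to$ denote entrywise convergence in $\mathcal R_1$. For $k\ge j$ let $(\Phi_n)_{k,j}$ and $(\Phi_n^\sharp)_{k,j}$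 be the coefficients of $X^{k-j}$ in $\varphi_n(X,j)$ and $\varphi_n^\sharp(X,j)$, respectively. *Spectral factor.* For Hilbert spaces $F_0,F_1,\dots$, consider lower triangular arrays $\Theta=[\Theta_{k,j}]$, $\Theta_{k,j}\in F_k$, with columns $c_j(\Theta)\in\bigoplus_{k\ge j}F_k$; such $\Theta$ is outer if $\{c_j(\Theta)\}_{j\ge k}$ is total in $\bigoplus_{i\ge k}F_i$ for every $k\ge 0$. Put $K_\Theta(k,j)=c_k(\Theta)^*c_j(\Theta)$, and write $K_1\le K_2$ if $K_2-K_1$ is a positive definite kernel, i.e. $\sum_{k,j}\overline{x}_k(K_2-K_1)(k,j)x_j\ge 0$ for all finitely supported $x$. A spectral factor of $K_\phi$ is an outer $\Theta$ with $K_\Theta\le K_\phi$ such that $K_{\Theta'}\le K_\Theta$ for every outer $\Theta'$ (with any Hilbert spaces $F'_k$) with $K_{\Theta'}\le K_\phi$; here the spaces $F_k$ are taken to be subspaces of $\mathbb C$, so that $\Theta\in\mathcal R_1$, and $\Theta$ is normalized by $\Theta_{n,n}\ge0$. The functional $\phi$ belongs to the Szegő class if $K_\phi$ has such a spectral factor with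 $\Theta_{n,n}>0$ for all $n$. **Theorem.** The functional $\phi$ belongs to the Szegő class if and only if $s_{k,k}\prod_{n>k}d_{k,n}>0$ for every $k\ge0$. In this case the normalized spectral factor $\Theta_\phi$ of $K_\phi$ is unique, every $\Phi_n^\sharp$ is invertible in $\mathcal R_1$, and $$\Phi_n\to0,\qquad(\Phi_n^\sharp)^{-1}\to\Theta_\phi\qquad(n\to\infty).$$ -/

import Mathlib

open Filter Topology Polynomial
open scoped ComplexOrder ComplexConjugate

namespace SzegoArrays

noncomputable section

/-! ### Functionals on noncommutative polynomials in `X₁` and `X₂ = 𝒥(X₁)` -/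

/-- Noncommutative complex polynomials in two indeterminates: finite linear combinations of words
in the letters `0` (for `X₁`) and `1` (for `X₂`). -/
abbrev NCPoly : Type := MonoidAlgebra ℂ (FreeMonoid (Fin 2))

/-- The indeterminate `X₁`. -/
def X₁ : NCPoly := MonoidAlgebra.single (FreeMonoid.of 0) 1

/-- The involution on words: reverse the word and exchange the two letters. -/
def wordInvol (σ : FreeMonoid (Fin 2)) : FreeMonoid (Fin 2) :=
  (FreeMonoid.map Fin.rev σ).reverse

/-- The involution `𝒥 (∑ c_σ X_σ) = ∑ conj c_σ 𝒥(X_σ)`. -/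
def invol (Q : NCPoly) : NCPoly :=
  Q.coeff.sum fun σ c => MonoidAlgebra.single (wordInvol σ) (conj c)

/-- `φ(𝒥(P) P) > 0` for every nonzero polynomial `P` in `X₁` alone. -/
def IsStrictlyPositiveFunctional (φ : NCPoly →ₗ[ℂ] ℂ) : Prop :=
  ∀ P ∈ Algebra.adjoin ℂ {X₁}, P ≠ 0 → 0 < φ (invol P * P)

/-- The kernel `K_φ(k, j) = s_{k,j} = φ(𝒥(X₁^k) X₁^j)`. -/
def momentKernel (φ : NCPoly →ₗ[ℂ] ℂ) : Matrix ℕ ℕ ℂ :=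
  Matrix.of fun k j => φ (invol (X₁ ^ k) * X₁ ^ j)

/-! ### Parameters of a kernel -/

/-- `(1 - |γ|²)^{1/2}`. -/
def defect (g : ℂ) : ℝ := Real.sqrt (1 - ‖g‖ ^ 2)

/-- The `N × N` matrix which is `[[γ, d], [d, -conj γ]]` in the rows and columns `i, i + 1` and the
identity elsewhere. -/
def schurRotation (N i : ℕ) (g : ℂ) : Matrix (Fin N) (Fin N) ℂ :=
  Matrix.of fun r c =>
    if r.val = i ∧ c.val = i then g
    else if r.val = i ∧ c.val = i + 1 then (defect g : ℂ)
    else if r.val = i + 1 ∧ c.val = i then (defect g : ℂ)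
    else if r.val = i + 1 ∧ c.val = i + 1 then -conj g
    else if r = c then 1 else 0

/-- `schurRotation 0 γ_{k,k+1} * schurRotation 1 γ_{k,k+2} * ⋯ * schurRotation (n-1) γ_{k,k+n}`. -/
def schurChain (γ : ℕ → ℕ → ℂ) (N k : ℕ) : ℕ → Matrix (Fin N) (Fin N) ℂ
  | 0 => 1
  | n + 1 => schurChain γ N k n * schurRotation N n (γ k (k + n + 1))

/-- The unitary `U_{k,k+n}`, acting on the first `n + 1` of `N` coordinates: the product of the
chains of `γ_{k,k+1}, …, γ_{k,k+n}`, then of `γ_{k+1,k+2}, …, γ_{k+1,k+n}`, …, and finally of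
`γ_{k+n-1,k+n}`. -/
def latticeU (γ : ℕ → ℕ → ℂ) (N : ℕ) : ℕ → ℕ → Matrix (Fin N) (Fin N) ℂ
  | _, 0 => 1
  | k, n + 1 => schurChain γ N k (n + 1) * latticeU γ N (k + 1) n

/-- `γ = {γ_{k,j}}_{k<j}` is the family of parameters of the kernel `K`:
`s_{k,j} = s_{k,k}^{1/2} (U_{k,j})_{0,0} s_{j,j}^{1/2}`. Entries outside `k < j`, which have no
meaning, are set to `0`. -/
structure IsParameterFamily (K : Matrix ℕ ℕ ℂ) (γ : ℕ → ℕ → ℂ) : Prop where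
  norm_lt_one : ∀ k j, k < j → ‖γ k j‖ < 1
  eq_zero : ∀ k j, j ≤ k → γ k j = 0
  kernel_eq : ∀ k n, K k (k + n) =
    (Real.sqrt (K k k).re : ℂ) * latticeU γ (n + 1) k n 0 0 *
      (Real.sqrt (K (k + n) (k + n)).re : ℂ)

/-! ### Shifted orthogonal polynomials -/

/-- The pair `(φ_n(X,l), φ_n^♯(X,l))`, by recursion on `n`. -/
def polyPair (K : Matrix ℕ ℕ ℂ) (γ : ℕ → ℕ → ℂ) : ℕ → ℕ → ℂ[X] × ℂ[X]
  | 0, l => (C (((Real.sqrt (K l l).re)⁻¹ : ℝ) : ℂ), C (((Real.sqrt (K l l).re)⁻¹ : ℝ) : ℂ))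
  | n + 1, l =>
    (C (((defect (γ l (n + 1 + l)))⁻¹ : ℝ) : ℂ) *
        (X * (polyPair K γ n (l + 1)).1 - C (γ l (n + 1 + l)) * (polyPair K γ n l).2),
      C (((defect (γ l (n + 1 + l)))⁻¹ : ℝ) : ℂ) *
        (-C (conj (γ l (n + 1 + l))) * X * (polyPair K γ n (l + 1)).1 + (polyPair K γ n l).2))

/-- `φ_n(X,l)`. -/
def orthPoly (K : Matrix ℕ ℕ ℂ) (γ : ℕ → ℕ → ℂ) (n l : ℕ) : ℂ[X] := (polyPair K γ n l).1

/-- `φ_n^♯(X,l)`. -/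
def orthPolySharp (K : Matrix ℕ ℕ ℂ) (γ : ℕ → ℕ → ℂ) (n l : ℕ) : ℂ[X] := (polyPair K γ n l).2

/-- The shifted kernel `K^l(α, β) = K(α + l, β + l)`. -/
def shiftKernel (K : Matrix ℕ ℕ ℂ) (l : ℕ) : Matrix ℕ ℕ ℂ :=
  Matrix.of fun α β => K (α + l) (β + l)

/-- The form `⟨P, Q⟩ = ∑ conj (q_α) K(α, β) p_β` on polynomials. -/
def polyInner (K : Matrix ℕ ℕ ℂ) (P Q : ℂ[X]) : ℂ :=
  P.sum fun β p => Q.sum fun α q => conj q * K α β * p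

/-- `p` is the family of orthogonal polynomials of the kernel `K`, i.e. the result of the
Gram-Schmidt procedure applied to `1, X, X², …`. -/
structure IsOrthogonalFamily (K : Matrix ℕ ℕ ℂ) (p : ℕ → ℂ[X]) : Prop where
  natDegree_eq : ∀ n, (p n).natDegree = n
  leadingCoeff_pos : ∀ n, 0 < (p n).leadingCoeff
  orthonormal : ∀ n m, polyInner K (p n) (p m) = if n = m then 1 else 0

/-! ### The algebra of lower triangular arrays -/

/-- Lower triangular arrays `[a_{k,j}]` with complex entries (`a_{k,j} = 0` for `k < j`), with
entrywise addition and `(ab)_{k,j} = ∑_l a_{k,l} b_{l,j}`: the incidence algebra of `ℕ` with the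
reversed order. -/
abbrev LowerArray : Type := IncidenceAlgebra ℂ ℕᵒᵈ

/-- The entry `a_{k,j}`. -/
def entry (a : LowerArray) (k j : ℕ) : ℂ := a (OrderDual.toDual k) (OrderDual.toDual j)

/-- The array whose `(k, j)` entry, for `j ≤ k`, is `f k j`. -/
def mkArray (f : ℕ → ℕ → ℂ) : LowerArray where
  toFun k j := if OrderDual.ofDual j ≤ OrderDual.ofDual k
    then f (OrderDual.ofDual k) (OrderDual.ofDual j) else 0
  eq_zero_of_not_le' := fun _ _ h => if_neg h

/-- The array `Φ_n`: its column `j` holds the coefficients of `φ_n(X,j)`, from the diagonal down. -/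
def arrayPhi (K : Matrix ℕ ℕ ℂ) (γ : ℕ → ℕ → ℂ) (n : ℕ) : LowerArray :=
  mkArray fun k j => (orthPoly K γ n j).coeff (k - j)

/-- The array `Φ_n^♯`: its column `j` holds the coefficients of `φ_n^♯(X,j)`, from the diagonal
down. -/
def arrayPhiSharp (K : Matrix ℕ ℕ ℂ) (γ : ℕ → ℕ → ℂ) (n : ℕ) : LowerArray :=
  mkArray fun k j => (orthPolySharp K γ n j).coeff (k - j)

/-- Entrywise convergence of a sequence of arrays. -/
def ConvergesTo (a : ℕ → LowerArray) (b : LowerArray) : Prop :=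
  ∀ k j, Tendsto (fun n => entry (a n) k j) atTop (𝓝 (entry b k j))

/-! ### Spectral factorization -/

/-- The order on kernels: `K₂ - K₁` is positive (semi)definite. -/
def KernelLE (K₁ K₂ : Matrix ℕ ℕ ℂ) : Prop := (K₂ - K₁).PosSemidef

section Family

variable {F : ℕ → Type*} [∀ n, NormedAddCommGroup (F n)] [∀ n, InnerProductSpace ℂ (F n)]

/-- An array `Θ_{k,j} ∈ ℒ(ℂ, F_k) = F_k`, given by its square summable columns
`c_j ∈ ⨁ F_k`, is lower triangular. -/
def IsLowerTriangular (c : ℕ → lp F 2) : Prop := ∀ j k, k < j → c j k = 0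

/-- For each `k`, the columns `c_j`, `j ≥ k`, are total in `⨁_{i ≥ k} F_i`. -/
def IsOuter (c : ℕ → lp F 2) : Prop :=
  ∀ k, closure (Submodule.span ℂ {x | ∃ j, k ≤ j ∧ x = c j} : Set (lp F 2)) =
    {x | ∀ i, i < k → x i = 0}

/-- `K_Θ(k, j) = c_k(Θ)^* c_j(Θ)`. -/
def columnKernel (c : ℕ → lp F 2) : Matrix ℕ ℕ ℂ := Matrix.of fun k j => inner ℂ (c k) (c j)

/-- The outer lower triangular array with columns `c` satisfies `K_Θ ≤ K` and is maximal among all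
outer lower triangular arrays with this property, for all families of Hilbert spaces. -/
structure IsMaximalOuter (K : Matrix ℕ ℕ ℂ) (c : ℕ → lp F 2) : Prop where
  lower : IsLowerTriangular c
  outer : IsOuter c
  le : KernelLE (columnKernel c) K
  maximal : ∀ (F' : ℕ → Type) [∀ n, NormedAddCommGroup (F' n)]
    [∀ n, InnerProductSpace ℂ (F' n)] [∀ n, CompleteSpace (F' n)] (c' : ℕ → lp F' 2),
    IsLowerTriangular c' → IsOuter c' → KernelLE (columnKernel c') K →
      KernelLE (columnKernel c') (columnKernel c)

end Family

/-- `Θ` is the spectral factor of the scalar kernel `K`, normalized by `Θ_{n,n} ≥ 0`. As the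
spaces `F_n` are at most one-dimensional, they are taken to be subspaces of `ℂ`. -/
def IsSpectralFactor (K : Matrix ℕ ℕ ℂ) (Θ : LowerArray) : Prop :=
  ∃ (F : ℕ → Submodule ℂ ℂ) (c : ℕ → lp (fun n => F n) 2),
    IsMaximalOuter K c ∧ (∀ k j, entry Θ k j = (c j k : ℂ)) ∧ ∀ n, 0 ≤ entry Θ n n

/-- `K` belongs to the Szegő class: its spectral factor has a positive diagonal. -/
def IsSzegoClass (K : Matrix ℕ ℕ ℂ) : Prop :=
  ∃ Θ, IsSpectralFactor K Θ ∧ ∀ n, 0 < entry Θ n n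

/-- `s_{k,k} ∏_{n>k} d_{k,n} > 0` for all `k`. -/
def HasPositiveProducts (K : Matrix ℕ ℕ ℂ) (γ : ℕ → ℕ → ℂ) : Prop :=
  ∀ k, ∃ g : ℝ, 0 < g ∧
    Tendsto (fun m => (K k k).re * ∏ n ∈ Finset.Ioc k m, defect (γ k n)) atTop (𝓝 g)

end

end SzegoArrays

open SzegoArrays

/-!
Realize the kernel as the Gram matrix of linearly independent vectors `v_k` of a Hilbert space. The
parameter `γ_{l,l+n}` is the inner product of the normalized residuals of `v_l` and `v_{l+n}` modulo
the vectors in between. Under `X^i ↦ v_{l+i}`, the polynomial `φ_n(X,l)` becomes the normalized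
residual of `v_{l+n}` modulo `v_l, …, v_{l+n-1}`, and `φ_n^♯(X,l)` that of `v_l` modulo
`v_{l+1}, …, v_{l+n}`. The unnormalized residual of `v_l` has norm `‖v_l‖ ∏ d_{l,i}` and converges
to the innovation of `v_l`, its residual modulo all later vectors, so that the products are positive
if and only if no innovation vanishes.

The coefficients `Θ_{k,j} = ⟪e_k, v_j⟫` along the normalized innovations `e_k` form the spectral
factor: what the expansion of a vector along the `e_k` leaves out lies in the closed span of every
tail of `v`, hence is annihilated by every contraction taking the `v_j` to the columns of a lower
triangular array. Finally `Θ Φ_n^♯` has entries `⟪e_k, backward residual⟫`, which tend to those of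
the identity, and `Θ Φ_n` has entries `⟪e_k, forward residual⟫`, which tend to `0` by Bessel's
inequality; as `Θ` is triangular with nonzero diagonal, this determines the limits of `Φ_n` and
`(Φ_n^♯)⁻¹`.
-/

namespace SzegoArrays

noncomputable section

universe u w

/-! ### Kernels as Gram matrices -/

section Gram

open Matrix

variable {ι 𝕜 H H' : Type*} [RCLike 𝕜] [SeminormedAddCommGroup H] [InnerProductSpace 𝕜 H]
  [SeminormedAddCommGroup H'] [InnerProductSpace 𝕜 H']

lemma quadraticForm_gram (v : ι → H) (x : ι →₀ 𝕜) :
    (x.sum fun i xi => x.sum fun j xj => star xi * gram 𝕜 v i j * xj) =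
      ((‖Finsupp.linearCombination 𝕜 v x‖ ^ 2 : ℝ) : 𝕜) := by
  rw [RCLike.ofReal_pow, ← inner_self_eq_norm_sq_to_K, Finsupp.linearCombination_apply,
    Finsupp.sum_inner]
  refine Finsupp.sum_congr fun i _ => ?_
  rw [Finsupp.inner_sum]
  refine Finsupp.sum_congr fun j _ => ?_
  simp only [inner_smul_right, inner_smul_left, starRingEnd_apply, gram_apply]
  ring

lemma linearIndependent_of_gram_posDef {v : ι → H} (hv : (gram 𝕜 v).PosDef) :
    LinearIndependent 𝕜 v := by
  refine linearIndependent_iff.2 fun x hx => ?_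
  by_contra hne
  simpa only [quadraticForm_gram, hx, norm_zero, ne_eq, OfNat.ofNat_ne_zero, not_false_eq_true,
    zero_pow, RCLike.ofReal_zero, lt_irrefl] using hv.2 hne

lemma posSemidef_gram_sub_gram_iff {v : ι → H} {w : ι → H'} :
    (gram 𝕜 v - gram 𝕜 w).PosSemidef ↔
      ∀ x, ‖Finsupp.linearCombination 𝕜 w x‖ ≤ ‖Finsupp.linearCombination 𝕜 v x‖ := by
  have form (x : ι →₀ 𝕜) :
      (x.sum fun i xi => x.sum fun j xj => star xi * (gram 𝕜 v - gram 𝕜 w) i j * xj) =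
        ((‖Finsupp.linearCombination 𝕜 v x‖ ^ 2 - ‖Finsupp.linearCombination 𝕜 w x‖ ^ 2 : ℝ) :
          𝕜) := by
    simp only [Matrix.sub_apply, mul_sub, sub_mul, Finsupp.sum_sub, quadraticForm_gram,
      RCLike.ofReal_sub]
  have hermitian : (gram 𝕜 v - gram 𝕜 w).IsHermitian :=
    (isHermitian_gram 𝕜 v).sub (isHermitian_gram 𝕜 w)
  simp only [Matrix.PosSemidef, hermitian, true_and, form, RCLike.ofReal_nonneg, sub_nonneg,
    sq_le_sq₀ (norm_nonneg _) (norm_nonneg _)]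

/-- The operator-valued kernel on the one-dimensional space `𝕜` with entries `K k j`. -/
def scalarKernel (K : Matrix ι ι 𝕜) : Matrix ι ι (𝕜 →L[𝕜] 𝕜) :=
  K.map fun a => a • 1

lemma scalarKernel_posSemidef {K : Matrix ι ι 𝕜} (hK : K.PosSemidef) :
    (scalarKernel K).PosSemidef := by
  have tfae := RKHS.posSemidef_tfae (K := scalarKernel K)
  refine (tfae.out 0 2 rfl rfl).2 ⟨?_, fun x => ?_⟩
  · ext i j
    simp [scalarKernel, ← hK.isHermitian.apply i j]
  · have conj_entry (i j : ι) : conj (K j i) = K i j := hK.isHermitian.apply i j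
    simpa [scalarKernel, conj_entry, mul_comm, mul_left_comm] using
      (RCLike.nonneg_iff.1 (hK.2 x)).1

theorem exists_gram_eq {ι : Type u} {𝕜 : Type w} [RCLike 𝕜] {K : Matrix ι ι 𝕜}
    (hK : K.PosSemidef) :
    ∃ (H : Type (max u w)) (_ : NormedAddCommGroup H) (_ : InnerProductSpace 𝕜 H)
      (_ : CompleteSpace H) (v : ι → H), K = gram 𝕜 v := by
  have : Fact (scalarKernel K).PosSemidef := ⟨scalarKernel_posSemidef hK⟩
  refine ⟨RKHS.OfKernel (scalarKernel K), inferInstance, inferInstance, inferInstance,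
    fun k => RKHS.kerFun _ k 1, ?_⟩
  ext k j
  rw [gram_apply, ← RKHS.kernel_inner, RKHS.OfKernel.kernel_ofKernel]
  simpa [scalarKernel] using (hK.isHermitian.apply k j).symm

end Gram

lemma KernelLE.antisymm {K₁ K₂ : Matrix ℕ ℕ ℂ} (h : KernelLE K₁ K₂) (h' : KernelLE K₂ K₁) :
    K₁ = K₂ := by
  obtain ⟨H, _, _, _, v, hv⟩ := exists_gram_eq h
  have neg_gram_posSemidef : (Matrix.gram ℂ (0 : ℕ → H) - Matrix.gram ℂ v).PosSemidef := by
    simpa only [Matrix.gram_zero, ← hv, zero_sub, neg_sub, KernelLE] using h'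
  have v_eq_zero : v = 0 := funext fun k => by
    simpa using posSemidef_gram_sub_gram_iff.1 neg_gram_posSemidef (Finsupp.single k 1)
  rw [v_eq_zero, Matrix.gram_zero, sub_eq_zero] at hv
  exact hv.symm

/-! ### The kernel of a strictly positive functional -/

lemma linearIndependent_X₁_pow : LinearIndependent ℂ fun k : ℕ => X₁ ^ k := by
  have pow_injective : Function.Injective fun k : ℕ => FreeMonoid.of (0 : Fin 2) ^ k :=
    fun a b h => by
      simpa [← ofAdd_nsmul] using
        congrArg (FreeMonoid.lift fun _ => Multiplicative.ofAdd (1 : ℕ)) h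
  have := (MonoidAlgebra.basis (FreeMonoid (Fin 2)) ℂ).linearIndependent.comp _ pow_injective
  convert this using 2 with k
  simp [X₁, MonoidAlgebra.single_pow]

lemma invol_add (P Q : NCPoly) : invol (P + Q) = invol P + invol Q := by
  simp only [invol, MonoidAlgebra.coeff_add]
  exact Finsupp.sum_add_index' (by simp) (by simp)

lemma invol_smul (c : ℂ) (P : NCPoly) : invol (c • P) = conj c • invol P := by
  simp only [invol, MonoidAlgebra.coeff_smul]
  rw [Finsupp.sum_smul_index (by simp), Finsupp.smul_sum]
  simp

lemma invol_linearCombination {ι : Type*} (f : ι → NCPoly) (x : ι →₀ ℂ) :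
    invol (Finsupp.linearCombination ℂ f x) = x.sum fun i xi => conj xi • invol (f i) := by
  simp only [Finsupp.linearCombination_apply, Finsupp.sum, ← invol_smul]
  exact map_sum (AddMonoidHom.mk' invol invol_add) _ _

lemma quadraticForm_momentKernel (φ : NCPoly →ₗ[ℂ] ℂ) (x : ℕ →₀ ℂ) :
    (x.sum fun i xi => x.sum fun j xj => star xi * momentKernel φ i j * xj) =
      φ (invol (Finsupp.linearCombination ℂ (X₁ ^ ·) x) *
        Finsupp.linearCombination ℂ (X₁ ^ ·) x) := by
  rw [invol_linearCombination, Finsupp.linearCombination_apply]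
  simp only [Finsupp.sum, Finset.sum_mul_sum, map_sum, momentKernel, Matrix.of_apply,
    smul_mul_assoc, mul_smul_comm, map_smul, smul_eq_mul, starRingEnd_apply]
  refine Finset.sum_congr rfl fun i _ => Finset.sum_congr rfl fun j _ => ?_
  ring

lemma isHermitian_of_quadraticForm_im_eq_zero {ι : Type*} {K : Matrix ι ι ℂ}
    (h : ∀ x : ι →₀ ℂ, (x.sum fun i xi => x.sum fun j xj => star xi * K i j * xj).im = 0) :
    K.IsHermitian := by
  have diag (k : ι) (b : ℂ) : (star b * K k k * b).im = 0 := by simpa using h (Finsupp.single k b)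
  ext i j
  have polarization (b : ℂ) : (K i j * b + star b * K j i).im = 0 := by
    have form_add : (K i i + K i j * b + (star b * K j i + star b * K j j * b)).im = 0 := by
      have := h (Finsupp.single i 1 + Finsupp.single j b)
      rw [Finsupp.sum_add_index' (by simp) (by intros; simp [add_mul, Finsupp.sum_add])] at this
      simpa [Finsupp.sum_add_index', mul_add] using this
    have diag_i : (K i i).im = 0 := by simpa using diag i 1
    simp only [Complex.add_im, diag_i, diag j b] at form_add ⊢
    linarith
  have re_eq := polarization Complex.I
  have im_eq := polarization 1
  simp only [Complex.add_im, Complex.mul_im, Complex.star_def, Complex.conj_I, Complex.neg_re,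
    Complex.neg_im, Complex.I_re, Complex.I_im, map_one, Complex.one_re, Complex.one_im]
    at re_eq im_eq
  rw [Matrix.conjTranspose_apply, Complex.star_def]
  apply Complex.ext
  · rw [Complex.conj_re]
    linarith
  · rw [Complex.conj_im]
    linarith

theorem momentKernel_posDef {φ : NCPoly →ₗ[ℂ] ℂ} (hφ : IsStrictlyPositiveFunctional φ) :
    (momentKernel φ).PosDef := by
  have pos (x : ℕ →₀ ℂ) (hx : x ≠ 0) :
      0 < x.sum fun i xi => x.sum fun j xj => star xi * momentKernel φ i j * xj := by
    rw [quadraticForm_momentKernel]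
    refine hφ _ ?_ ((map_ne_zero_iff _ linearIndependent_X₁_pow).2 hx)
    rw [Finsupp.linearCombination_apply]
    exact Subalgebra.sum_mem _ fun i _ => Subalgebra.smul_mem _
      (Subalgebra.pow_mem _ (Algebra.subset_adjoin (Set.mem_singleton _)) _) _
  refine ⟨isHermitian_of_quadraticForm_im_eq_zero fun x => ?_, pos⟩
  obtain rfl | hx := eq_or_ne x 0
  · simp
  · exact (Complex.pos_iff.1 (pos x hx)).2.symm

/-! ### Lower triangular arrays -/

lemma entry_of_lt (a : LowerArray) {k j : ℕ} (h : k < j) : entry a k j = 0 :=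
  IncidenceAlgebra.apply_eq_zero_of_not_le (fun h' => h.not_ge (OrderDual.toDual_le_toDual.1 h')) a

lemma entry_ext {a b : LowerArray} (h : ∀ k j, entry a k j = entry b k j) : a = b :=
  IncidenceAlgebra.ext fun k j _ => h (OrderDual.ofDual k) (OrderDual.ofDual j)

lemma entry_mkArray (f : ℕ → ℕ → ℂ) (k j : ℕ) :
    entry (mkArray f) k j = if j ≤ k then f k j else 0 := rfl

lemma entry_zero (k j : ℕ) : entry 0 k j = 0 := rfl

lemma entry_one (k j : ℕ) : entry 1 k j = if k = j then 1 else 0 := by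
  simp [entry]

lemma entry_mul (a b : LowerArray) (k j : ℕ) :
    entry (a * b) k j = ∑ l ∈ Finset.Icc j k, entry a k l * entry b l j := by
  simp only [entry, IncidenceAlgebra.mul_apply, Finset.Icc_orderDual_def, Finset.sum_map]
  rfl

lemma entry_mul_eq_sum_Ico_add {a b : LowerArray} {k j : ℕ} (h : j ≤ k) :
    entry (a * b) k j =
      ∑ l ∈ Finset.Ico j k, entry a k l * entry b l j + entry a k k * entry b k j := by
  rw [entry_mul, ← Finset.Ico_insert_right h, Finset.sum_insert (by simp), add_comm]

/-- The entries in column `j` of the right inverse of `a`, obtained by forward substitution; they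
are meaningful when the diagonal of `a` does not vanish. -/
def rightInvEntry (a : LowerArray) (j k : ℕ) : ℂ :=
  (entry a k k)⁻¹ * ((if k = j then 1 else 0) -
    ∑ l : Finset.Ico j k, entry a k l * rightInvEntry a j l)
termination_by k
decreasing_by exact (Finset.mem_Ico.1 l.2).2

lemma mul_mkArray_rightInvEntry {a : LowerArray} (ha : ∀ k, entry a k k ≠ 0) :
    a * mkArray (fun k j => rightInvEntry a j k) = 1 := by
  refine entry_ext fun k j => ?_
  rcases lt_or_ge k j with h | h
  · rw [entry_of_lt _ h, entry_of_lt _ h]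
  have entry_rightInv (l) (hl : l ∈ Finset.Ico j k) :
      entry a k l * entry (mkArray fun k j => rightInvEntry a j k) l j =
        entry a k l * rightInvEntry a j l := by
    rw [entry_mkArray, if_pos (Finset.mem_Ico.1 hl).1]
  rw [entry_mul_eq_sum_Ico_add h, entry_one, Finset.sum_congr rfl entry_rightInv, entry_mkArray,
    if_pos h, rightInvEntry, mul_inv_cancel_left₀ (ha k),
    Finset.sum_coe_sort _ fun l => entry a k l * rightInvEntry a j l]
  ring

lemma isUnit_of_entry_diag_ne_zero {a : LowerArray} (ha : ∀ k, entry a k k ≠ 0) : IsUnit a := by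
  set b := mkArray fun k j => rightInvEntry a j k
  have mul_b : a * b = 1 := mul_mkArray_rightInvEntry ha
  have diag_b (k : ℕ) : entry b k k ≠ 0 := fun h => by
    simpa [entry_mul_eq_sum_Ico_add le_rfl, h, entry_one] using congrArg (entry · k k) mul_b
  have b_mul := mul_mkArray_rightInvEntry diag_b
  rw [← left_inv_eq_right_inv mul_b b_mul] at b_mul
  exact ⟨⟨a, b, mul_b, b_mul⟩, rfl⟩

lemma ConvergesTo.of_mul_left {b x : ℕ → LowerArray} {B Y : LowerArray} (hb : ConvergesTo b B)
    (hB : ∀ k, entry B k k ≠ 0) (h : ConvergesTo (fun n => b n * x n) (B * Y)) :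
    ConvergesTo x Y := by
  intro k j
  induction k using Nat.strong_induction_on with
  | _ k ih =>
    rcases lt_or_ge k j with hkj | hkj
    · simp only [entry_of_lt _ hkj]
      exact tendsto_const_nhds
    have diagonal_term : Tendsto (fun n => entry (b n) k k * entry (x n) k j) atTop
        (𝓝 (entry B k k * entry Y k j)) := by
      have earlier_terms :
          Tendsto (fun n => ∑ l ∈ Finset.Ico j k, entry (b n) k l * entry (x n) l j) atTop
            (𝓝 (∑ l ∈ Finset.Ico j k, entry B k l * entry Y l j)) :=
        tendsto_finsetSum _ fun l hl => (hb k l).mul (ih l (Finset.mem_Ico.1 hl).2)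
      simpa only [entry_mul_eq_sum_Ico_add hkj, add_sub_cancel_left] using
        (h k j).sub earlier_terms
    have quotient := diagonal_term.div (hb k k) (hB k)
    rw [mul_div_cancel_left₀ _ (hB k)] at quotient
    refine quotient.congr' ?_
    filter_upwards [(hb k k).eventually_ne (hB k)] with n hn
    exact mul_div_cancel_left₀ _ hn

/-! ### Products of elementary rotations -/

section Rotations

open Matrix

lemma defect_pos {g : ℂ} (h : ‖g‖ < 1) : 0 < defect g :=
  Real.sqrt_pos.2 (by nlinarith [norm_nonneg g])

variable {N i : ℕ} {a b : Fin N}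

lemma schurRotation_row_of_ne {r : Fin N} (h : r.val ≠ i) (h' : r.val ≠ i + 1) (g : ℂ) :
    schurRotation N i g r = (1 : Matrix (Fin N) (Fin N) ℂ) r := by
  ext c
  simp [schurRotation, h, h', Matrix.one_apply]

lemma schurRotation_transpose (N i : ℕ) (g : ℂ) :
    (schurRotation N i g)ᵀ = schurRotation N i g := by
  ext r c
  simp only [Matrix.transpose_apply, schurRotation, Matrix.of_apply, Fin.ext_iff]
  grind

lemma vecMul_schurRotation_of_ne (w : Fin N → ℂ) {c : Fin N} (h : c.val ≠ i)
    (h' : c.val ≠ i + 1) (g : ℂ) : (w ᵥ* schurRotation N i g) c = w c := by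
  simp [Matrix.vecMul, dotProduct, schurRotation, h, h']

lemma vecMul_schurRotation_fst (w : Fin N → ℂ) (ha : a.val = i) (hb : b.val = i + 1) (g : ℂ) :
    (w ᵥ* schurRotation N i g) a = w a * g + w b * defect g := by
  have hab : a ≠ b := fun h => by simp [← h, ha] at hb
  rw [Matrix.vecMul, dotProduct, Fintype.sum_eq_add a b hab]
  · simp [schurRotation, ha, hb]
  · rintro r ⟨hra, hrb⟩
    simp_all [schurRotation, Fin.ext_iff]

lemma vecMul_schurRotation_snd (w : Fin N → ℂ) (ha : a.val = i) (hb : b.val = i + 1) (g : ℂ) :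
    (w ᵥ* schurRotation N i g) b = w a * defect g - w b * conj g := by
  have hab : a ≠ b := fun h => by simp [← h, ha] at hb
  rw [Matrix.vecMul, dotProduct, Fintype.sum_eq_add a b hab]
  · simp [schurRotation, ha, hb, sub_eq_add_neg]
  · rintro r ⟨hra, hrb⟩
    simp_all [schurRotation, Fin.ext_iff]

lemma schurRotation_mulVec_snd (u : Fin N → ℂ) (ha : a.val = i) (hb : b.val = i + 1) (g : ℂ) :
    (schurRotation N i g *ᵥ u) b = u a * defect g - u b * conj g := by
  rw [← schurRotation_transpose, Matrix.mulVec_transpose, vecMul_schurRotation_snd u ha hb]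

lemma vecMul_schurRotation_dotProduct {w u : Fin N → ℂ} (ha : a.val = i) (hb : b.val = i + 1)
    (hw : w b = 0) (hu : u b = 0) (g : ℂ) :
    (w ᵥ* schurRotation N i g) ⬝ᵥ u = w ⬝ᵥ u + w a * (g - 1) * u a := by
  have term (c : Fin N) : (w ᵥ* schurRotation N i g) c * u c =
      w c * u c + if c = a then w a * (g - 1) * u a else 0 := by
    obtain rfl | hca := eq_or_ne c a
    · rw [vecMul_schurRotation_fst w ha hb, hw, if_pos rfl]
      ring
    rw [if_neg hca, add_zero]
    obtain rfl | hcb := eq_or_ne c b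
    · rw [hu, mul_zero, mul_zero]
    · rw [vecMul_schurRotation_of_ne w (by omega) (by omega)]
  simp only [dotProduct, term, Finset.sum_add_distrib, Finset.sum_ite_eq', Finset.mem_univ, if_true]

variable {γ γ' : ℕ → ℕ → ℂ} {n : ℕ}

lemma schurChain_apply_of_lt_col (k : ℕ) (r : Fin N) {c : Fin N} (hc : n < c.val) :
    schurChain γ N k n r c = (1 : Matrix (Fin N) (Fin N) ℂ) r c := by
  induction n with
  | zero => rfl
  | succ n ih =>
    rw [schurChain, Matrix.mul_apply_eq_vecMul,
      vecMul_schurRotation_of_ne _ (by omega) (by omega), ih (by omega)]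

lemma schurChain_row_of_lt (k : ℕ) {r : Fin N} (hr : n < r.val) :
    schurChain γ N k n r = (1 : Matrix (Fin N) (Fin N) ℂ) r := by
  induction n with
  | zero => rfl
  | succ n ih =>
    rw [schurChain, Matrix.mul_apply_eq_vecMul, ih (by omega), ← Matrix.mul_apply_eq_vecMul,
      one_mul, schurRotation_row_of_ne (by omega) (by omega)]

lemma latticeU_row_of_lt (k : ℕ) {r : Fin N} (hr : n < r.val) :
    latticeU γ N k n r = (1 : Matrix (Fin N) (Fin N) ℂ) r := by
  induction n generalizing k with
  | zero => rw [latticeU]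
  | succ n ih =>
    rw [latticeU, Matrix.mul_apply_eq_vecMul, schurChain_row_of_lt _ hr,
      ← Matrix.mul_apply_eq_vecMul, one_mul, ih _ (by omega)]

lemma schurChain_zero_last (k : ℕ) (ha : a.val = 0) (hb : b.val = n) :
    schurChain γ N k n a b = ∏ i ∈ Finset.range n, (defect (γ k (k + i + 1)) : ℂ) := by
  induction n generalizing b with
  | zero => rw [schurChain, Fin.ext (ha.trans hb.symm), Matrix.one_apply_eq, Finset.prod_range_zero]
  | succ n ih =>
    let c : Fin N := ⟨n, by omega⟩
    have hab : a ≠ b := by omega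
    rw [schurChain, Matrix.mul_apply_eq_vecMul, vecMul_schurRotation_snd _ (a := c) rfl hb,
      ih (b := c) rfl, schurChain_apply_of_lt_col _ _ (by omega), Matrix.one_apply_ne hab,
      zero_mul, sub_zero, Finset.prod_range_succ]

lemma latticeU_last_zero (k : ℕ) (ha : a.val = 0) (hb : b.val = n) :
    latticeU γ N k n b a = ∏ i ∈ Finset.range n, (defect (γ (k + i) (k + n)) : ℂ) := by
  induction n generalizing k b with
  | zero => rw [latticeU, Fin.ext (hb.trans ha.symm), Matrix.one_apply_eq, Finset.prod_range_zero]
  | succ n ih =>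
    let c : Fin N := ⟨n, by omega⟩
    have hba : b ≠ a := by omega
    have last_row : schurChain γ N k (n + 1) b = schurRotation N n (γ k (k + n + 1)) b := by
      rw [schurChain, Matrix.mul_apply_eq_vecMul, schurChain_row_of_lt _ (by omega),
        ← Matrix.mul_apply_eq_vecMul, one_mul]
    rw [latticeU, Matrix.mul_apply_eq_vecMul, last_row]
    change (schurRotation N n (γ k (k + n + 1)) *ᵥ fun r => latticeU γ N (k + 1) n r a) b = _
    rw [schurRotation_mulVec_snd _ (a := c) rfl hb, ih _ (b := c) rfl,
      latticeU_row_of_lt _ (by omega), Matrix.one_apply_ne hba, zero_mul, sub_zero,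
      Finset.prod_range_succ', add_zero]
    simp only [add_assoc, add_comm 1]

lemma schurChain_congr (k : ℕ) (h : ∀ i < n, γ k (k + i + 1) = γ' k (k + i + 1)) :
    schurChain γ N k n = schurChain γ' N k n := by
  induction n with
  | zero => rfl
  | succ n ih => rw [schurChain, schurChain, ih fun i hi => h i (by omega), h n (by omega)]

lemma latticeU_congr (k : ℕ) (h : ∀ m, ∀ i < n, γ m (m + i + 1) = γ' m (m + i + 1)) :
    latticeU γ N k n = latticeU γ' N k n := by
  induction n generalizing k with
  | zero => rw [latticeU, latticeU]
  | succ n ih =>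
    rw [latticeU, latticeU, schurChain_congr k (h k), ih _ fun m i hi => h m i (by omega)]

lemma latticeU_succ_zero_zero (k : ℕ) (ha : a.val = 0) (hb : b.val = n) (hn : n + 1 < N) :
    latticeU γ N k (n + 1) a a =
      (schurChain γ N k n * latticeU γ N (k + 1) n) a a +
        schurChain γ N k n a b * (γ k (k + n + 1) - 1) * latticeU γ N (k + 1) n b a := by
  let c : Fin N := ⟨n + 1, hn⟩
  have hac : a ≠ c := Fin.ne_of_val_ne (by simp [c, ha])
  exact vecMul_schurRotation_dotProduct hb (b := c) rfl
    (by rw [schurChain_apply_of_lt_col _ _ (by simp [c]), Matrix.one_apply_ne hac])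
    (by rw [latticeU_row_of_lt _ (by simp [c]), Matrix.one_apply_ne hac.symm]) _

lemma latticeU_zero_zero_sub (k : ℕ) (ha : a.val = 0) (hn : n + 1 < N)
    (h : ∀ m, ∀ i < n, γ m (m + i + 1) = γ' m (m + i + 1)) :
    latticeU γ N k (n + 1) a a - latticeU γ' N k (n + 1) a a =
      (∏ i ∈ Finset.range n, (defect (γ' k (k + i + 1)) : ℂ)) *
        (γ k (k + n + 1) - γ' k (k + n + 1)) *
          ∏ i ∈ Finset.range n, (defect (γ' (k + 1 + i) (k + 1 + n)) : ℂ) := by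
  obtain ⟨b, hb⟩ : ∃ b : Fin N, b.val = n := ⟨⟨n, by omega⟩, rfl⟩
  rw [latticeU_succ_zero_zero k ha hb hn, latticeU_succ_zero_zero k ha hb hn,
    schurChain_congr k (h k), latticeU_congr (k + 1) h, schurChain_zero_last k ha hb,
    latticeU_last_zero (k + 1) ha hb]
  ring

theorem IsParameterFamily.unique {K : Matrix ℕ ℕ ℂ} (hK : ∀ k, 0 < (K k k).re)
    (h : IsParameterFamily K γ) (h' : IsParameterFamily K γ') : γ = γ' := by
  have sqrt_ne_zero (k : ℕ) : (Real.sqrt (K k k).re : ℂ) ≠ 0 := by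
    exact_mod_cast (Real.sqrt_pos.2 (hK k)).ne'
  have defect_ne_zero {p q : ℕ} (hpq : p < q) : (defect (γ' p q) : ℂ) ≠ 0 := by
    exact_mod_cast (defect_pos (h'.norm_lt_one p q hpq)).ne'
  have diagonal (n k : ℕ) : γ k (k + n + 1) = γ' k (k + n + 1) := by
    induction n using Nat.strong_induction_on generalizing k with
    | _ n ih =>
      have corner_eq : latticeU γ (n + 2) k (n + 1) 0 0 = latticeU γ' (n + 2) k (n + 1) 0 0 :=
        mul_left_cancel₀ (sqrt_ne_zero _) (mul_right_cancel₀ (sqrt_ne_zero _)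
          ((h.kernel_eq k (n + 1)).symm.trans (h'.kernel_eq k (n + 1))))
      have corner_sub := latticeU_zero_zero_sub (N := n + 2) (a := 0) k rfl (by omega)
        fun m i hi => ih i hi m
      rw [corner_eq, sub_self, eq_comm, mul_eq_zero, mul_eq_zero, sub_eq_zero] at corner_sub
      refine (corner_sub.resolve_right ?_).resolve_left ?_ <;>
        exact Finset.prod_ne_zero_iff.2 fun i hi =>
          defect_ne_zero (by have := Finset.mem_range.1 hi; omega)
  funext k j
  rcases lt_or_ge k j with hkj | hkj
  · obtain ⟨n, rfl⟩ := Nat.exists_eq_add_of_lt hkj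
    exact diagonal n k
  · rw [h.eq_zero _ _ hkj, h'.eq_zero _ _ hkj]

end Rotations

/-! ### Residuals of orthogonal projections -/

section Residual

open Submodule

variable {H : Type*} [NormedAddCommGroup H] [InnerProductSpace ℂ H]

/-- The residual map of a subspace `W`, sending `x` to the error of the best approximation of `x`
by elements of `W`, as the orthogonal projection onto `Wᗮ`. -/
abbrev residual (W : Submodule ℂ H) [W.HasOrthogonalProjection] : H →L[ℂ] H := Wᗮ.starProjection

/-- The residual of `x` modulo `W`, scaled to norm `1`; it is `0` for `x ∈ W`. -/
def unitResidual (W : Submodule ℂ H) [W.HasOrthogonalProjection] (x : H) : H :=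
  ((‖residual W x‖⁻¹ : ℝ) : ℂ) • residual W x

variable {W W' : Submodule ℂ H} [W.HasOrthogonalProjection] {x y : H}

lemma sub_residual_mem (W : Submodule ℂ H) [W.HasOrthogonalProjection] (x : H) :
    x - residual W x ∈ W := by
  rw [starProjection_orthogonal_val, sub_sub_cancel]
  exact starProjection_apply_mem W x

lemma residual_eq_zero_iff : residual W x = 0 ↔ x ∈ W := by
  refine ⟨fun h => by simpa only [h, sub_zero] using sub_residual_mem W x, fun h => ?_⟩
  exact (starProjection_apply_eq_zero_iff _).2 (le_orthogonal_orthogonal W h)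

lemma residual_bot (x : H) : residual (⊥ : Submodule ℂ H) x = x := by
  rw [starProjection_orthogonal_val, starProjection_bot, zero_apply, sub_zero]

lemma unitResidual_bot (x : H) :
    unitResidual (⊥ : Submodule ℂ H) x = ((‖x‖⁻¹ : ℝ) : ℂ) • x := by
  rw [unitResidual, residual_bot]

lemma unitResidual_mem_orthogonal (W : Submodule ℂ H) [W.HasOrthogonalProjection] (x : H) :
    unitResidual W x ∈ Wᗮ :=
  smul_mem _ _ (starProjection_apply_mem _ x)

lemma unitResidual_mem (hW : W ≤ W') (hx : x ∈ W') : unitResidual W x ∈ W' := by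
  refine smul_mem _ _ ?_
  rw [← sub_sub_cancel x (residual W x)]
  exact sub_mem hx (hW (sub_residual_mem W x))

lemma norm_unitResidual (hx : residual W x ≠ 0) : ‖unitResidual W x‖ = 1 := by
  rw [unitResidual, norm_smul, Complex.norm_real, norm_inv, norm_norm,
    inv_mul_cancel₀ (norm_ne_zero_iff.2 hx)]

lemma norm_smul_unitResidual (W : Submodule ℂ H) [W.HasOrthogonalProjection] (x : H) :
    ((‖residual W x‖ : ℝ) : ℂ) • unitResidual W x = residual W x := by
  obtain h | h := eq_or_ne (residual W x) 0
  · simp only [unitResidual, h, smul_zero]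
  · rw [unitResidual, Complex.ofReal_inv, smul_inv_smul₀]
    exact_mod_cast norm_ne_zero_iff.2 h

lemma inner_residual_left (W : Submodule ℂ H) [W.HasOrthogonalProjection] (x y : H) :
    inner ℂ (residual W x) y = inner ℂ (residual W x) (residual W y) := by
  rw [← inner_starProjection_left_eq_right,
    starProjection_eq_self_iff.2 (starProjection_apply_mem _ x)]

lemma inner_unitResidual (W : Submodule ℂ H) [W.HasOrthogonalProjection] (x y : H) :
    inner ℂ (unitResidual W y) x =
      ‖residual W x‖ * inner ℂ (unitResidual W y) (unitResidual W x) := by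
  rw [← inner_smul_right, norm_smul_unitResidual, ← inner_starProjection_left_eq_right,
    starProjection_eq_self_iff.2 (unitResidual_mem_orthogonal W y)]

lemma inner_mul_inner_unitResidual (W : Submodule ℂ H) [W.HasOrthogonalProjection] (x y : H) :
    inner ℂ y (unitResidual W y) * inner ℂ (unitResidual W y) x = inner ℂ (residual W y) x := by
  obtain h | h := eq_or_ne (residual W y) 0
  · simp only [unitResidual, h, smul_zero, inner_zero_left, inner_zero_right, mul_zero]
  have hy : inner ℂ y (residual W y) = (‖residual W y‖ : ℂ) ^ 2 := by
    rw [← inner_conj_symm, inner_residual_left, inner_self_eq_norm_sq_to_K, map_pow]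
    exact congrArg (· ^ 2) (Complex.conj_ofReal _)
  have h' : (‖residual W y‖ : ℂ) ≠ 0 := by exact_mod_cast norm_ne_zero_iff.2 h
  rw [unitResidual, inner_smul_right, inner_smul_left, hy, Complex.conj_ofReal, Complex.ofReal_inv]
  field_simp

variable [W'.HasOrthogonalProjection]

lemma residual_sup_span_singleton (h : W' = W ⊔ ℂ ∙ y) (x : H) :
    residual W' x = residual W x - inner ℂ (unitResidual W y) x • unitResidual W y := by
  have hW : W ≤ W' := h ▸ le_sup_left
  have hy : y ∈ W' := h ▸ mem_sup_right (mem_span_singleton_self y)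
  refine eq_starProjection_of_mem_orthogonal ?_ (le_orthogonal_orthogonal _ ?_)
  · rw [h, ← inf_orthogonal, mem_inf, mem_orthogonal_singleton_iff_inner_right]
    refine ⟨sub_mem (starProjection_apply_mem _ x)
      (smul_mem _ _ (unitResidual_mem_orthogonal W y)), ?_⟩
    rw [inner_sub_right, inner_smul_right, mul_comm, inner_mul_inner_unitResidual,
      inner_starProjection_left_eq_right, sub_self]
  · rw [← sub_add]
    exact add_mem (hW (sub_residual_mem W x)) (smul_mem _ _ (unitResidual_mem hW hy))

lemma mem_of_mem_sup_span_singleton (h : W' = W ⊔ ℂ ∙ y) (hx : x ∈ W')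
    (hxy : inner ℂ (unitResidual W y) x = 0) : x ∈ W := by
  rw [← residual_eq_zero_iff] at hx ⊢
  rwa [residual_sup_span_singleton h, hxy, zero_smul, sub_zero] at hx

lemma norm_sub_inner_smul {f g : H} (hf : ‖f‖ = 1) (hg : ‖g‖ = 1) :
    ‖f - inner ℂ g f • g‖ = defect (inner ℂ g f) := by
  have expand := norm_sub_sq (𝕜 := ℂ) f (inner ℂ g f • g)
  have cross : RCLike.re (inner ℂ g f * inner ℂ f g) = ‖inner ℂ g f‖ ^ 2 := by
    rw [← inner_conj_symm f g, RCLike.mul_conj]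
    norm_cast
  rw [inner_smul_right, norm_smul, hf, hg, cross] at expand
  rw [defect, ← Real.sqrt_sq (norm_nonneg (f - _)), expand]
  ring_nf

lemma residual_sup_span_singleton_eq_smul (h : W' = W ⊔ ℂ ∙ y) (x : H) :
    residual W' x = ((‖residual W x‖ : ℝ) : ℂ) • (unitResidual W x -
      inner ℂ (unitResidual W y) (unitResidual W x) • unitResidual W y) := by
  rw [residual_sup_span_singleton h, inner_unitResidual, mul_smul, smul_sub,
    norm_smul_unitResidual]

lemma norm_residual_sup_span_singleton (h : W' = W ⊔ ℂ ∙ y) (hx : residual W x ≠ 0)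
    (hy : residual W y ≠ 0) : ‖residual W' x‖ =
      ‖residual W x‖ * defect (inner ℂ (unitResidual W y) (unitResidual W x)) := by
  rw [residual_sup_span_singleton_eq_smul h, norm_smul, Complex.norm_real, norm_norm,
    norm_sub_inner_smul (norm_unitResidual hx) (norm_unitResidual hy)]

lemma unitResidual_sup_span_singleton (h : W' = W ⊔ ℂ ∙ y) (hx : residual W x ≠ 0)
    (hy : residual W y ≠ 0) : unitResidual W' x =
      (((defect (inner ℂ (unitResidual W y) (unitResidual W x)))⁻¹ : ℝ) : ℂ) •
        (unitResidual W x - inner ℂ (unitResidual W y) (unitResidual W x) • unitResidual W y) := by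
  have hx' : ‖residual W x‖ ≠ 0 := norm_ne_zero_iff.2 hx
  rw [unitResidual, norm_residual_sup_span_singleton h hx hy,
    residual_sup_span_singleton_eq_smul h, smul_smul, ← Complex.ofReal_mul, mul_inv,
    mul_right_comm, inv_mul_cancel₀ hx', one_mul]

lemma norm_inner_unitResidual_lt_one (h : W' = W ⊔ ℂ ∙ y) (hx : residual W' x ≠ 0)
    (hx' : residual W x ≠ 0) (hy : residual W y ≠ 0) :
    ‖inner ℂ (unitResidual W y) (unitResidual W x)‖ < 1 := by
  rw [← norm_pos_iff, norm_residual_sup_span_singleton h hx' hy] at hx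
  have := Real.sqrt_pos.1 (pos_of_mul_pos_right hx (norm_nonneg _))
  nlinarith

end Residual

/-! ### Forward and backward residuals of a sequence of vectors -/

section Lattice

open Submodule Matrix

variable {H : Type*} [NormedAddCommGroup H] [InnerProductSpace ℂ H]

/-- The span of `v k, …, v (k + n - 1)`. -/
def window (v : ℕ → H) (k n : ℕ) : Submodule ℂ H := span ℂ (v '' Set.Ico k (k + n))

instance (v : ℕ → H) (k n : ℕ) : FiniteDimensional ℂ (window v k n) :=
  FiniteDimensional.span_of_finite ℂ ((Set.finite_Ico _ _).image v)

/-- The normalized residual of `v (l + n)` modulo `v l, …, v (l + n - 1)`. -/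
def forward (v : ℕ → H) (n l : ℕ) : H := unitResidual (window v l n) (v (l + n))

/-- The normalized residual of `v l` modulo `v (l + 1), …, v (l + n)`. -/
def backward (v : ℕ → H) (n l : ℕ) : H := unitResidual (window v (l + 1) n) (v l)

/-- The parameter `γ_{l,l+n+1}` of the Gram matrix of `v`, as the partial correlation of `v l` and
`v (l + n + 1)` modulo the vectors in between. -/
def reflection (v : ℕ → H) (n l : ℕ) : ℂ := inner ℂ (backward v n l) (forward v n (l + 1))

variable {v : ℕ → H}

lemma mem_window {k n i : ℕ} (h : k ≤ i) (h' : i < k + n) : v i ∈ window v k n :=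
  subset_span ⟨i, ⟨h, h'⟩, rfl⟩

lemma window_mono {k n k' n' : ℕ} (h : k' ≤ k) (h' : k + n ≤ k' + n') :
    window v k n ≤ window v k' n' :=
  span_mono (Set.image_mono (Set.Ico_subset_Ico h h'))

lemma window_zero (v : ℕ → H) (k : ℕ) : window v k 0 = ⊥ := by
  simp [window]

lemma window_succ_left (v : ℕ → H) (k n : ℕ) :
    window v k (n + 1) = window v (k + 1) n ⊔ ℂ ∙ v k := by
  rw [window, window, ← span_union, ← Set.image_singleton, ← Set.image_union,
    show Set.Ico k (k + (n + 1)) = Set.Ico (k + 1) (k + 1 + n) ∪ {k} by ext; simp; omega]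

lemma window_succ_right (v : ℕ → H) (k n : ℕ) :
    window v k (n + 1) = window v k n ⊔ ℂ ∙ v (k + n) := by
  rw [window, window, ← span_union, ← Set.image_singleton, ← Set.image_union,
    show Set.Ico k (k + (n + 1)) = Set.Ico k (k + n) ∪ {k + n} by ext; simp; omega]

lemma residual_window_ne_zero (hv : LinearIndependent ℂ v) {k n i : ℕ} (h : i < k ∨ k + n ≤ i) :
    residual (window v k n) (v i) ≠ 0 :=
  residual_eq_zero_iff.not.2 (hv.notMem_span_image (by simp only [Set.mem_Ico]; omega))

lemma norm_forward (hv : LinearIndependent ℂ v) (n l : ℕ) : ‖forward v n l‖ = 1 :=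
  norm_unitResidual (residual_window_ne_zero hv (.inr le_rfl))

lemma forward_mem_window (v : ℕ → H) (n l : ℕ) : forward v n l ∈ window v l (n + 1) :=
  unitResidual_mem (window_mono le_rfl (by omega)) (mem_window (by omega) (by omega))

lemma forward_orthonormal (hv : LinearIndependent ℂ v) (l : ℕ) :
    Orthonormal ℂ fun n => forward v n l := by
  have inner_eq_zero {m n : ℕ} (h : m < n) : inner ℂ (forward v m l) (forward v n l) = 0 :=
    unitResidual_mem_orthogonal (window v l n) _ _
      (window_mono le_rfl (by omega) (forward_mem_window v m l))
  refine ⟨fun n => norm_forward hv n l, fun m n hmn => ?_⟩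
  obtain h | h := hmn.lt_or_gt
  · exact inner_eq_zero h
  · exact inner_eq_zero_symm.1 (inner_eq_zero h)

lemma forward_zero (v : ℕ → H) (l : ℕ) : forward v 0 l = ((‖v l‖⁻¹ : ℝ) : ℂ) • v l := by
  simp only [forward, window_zero, unitResidual_bot, add_zero]

lemma backward_zero (v : ℕ → H) (l : ℕ) : backward v 0 l = ((‖v l‖⁻¹ : ℝ) : ℂ) • v l := by
  simp only [backward, window_zero, unitResidual_bot]

lemma forward_succ (hv : LinearIndependent ℂ v) (n l : ℕ) : forward v (n + 1) l =
    (((defect (reflection v n l))⁻¹ : ℝ) : ℂ) •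
      (forward v n (l + 1) - reflection v n l • backward v n l) := by
  rw [forward, ← add_assoc, add_right_comm]
  exact unitResidual_sup_span_singleton (window_succ_left v l n)
    (residual_window_ne_zero hv (.inr le_rfl)) (residual_window_ne_zero hv (.inl l.lt_succ_self))

lemma conj_reflection (v : ℕ → H) (n l : ℕ) :
    conj (reflection v n l) = inner ℂ (forward v n (l + 1)) (backward v n l) :=
  inner_conj_symm _ _

lemma defect_conj (g : ℂ) : defect (conj g) = defect g := by
  rw [defect, RCLike.norm_conj, defect]

lemma backward_succ (hv : LinearIndependent ℂ v) (n l : ℕ) : backward v (n + 1) l =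
    (((defect (reflection v n l))⁻¹ : ℝ) : ℂ) •
      (backward v n l - conj (reflection v n l) • forward v n (l + 1)) := by
  rw [← defect_conj, conj_reflection]
  exact unitResidual_sup_span_singleton (window_succ_right v (l + 1) n)
    (residual_window_ne_zero hv (.inl l.lt_succ_self)) (residual_window_ne_zero hv (.inr le_rfl))

lemma norm_reflection_lt_one (hv : LinearIndependent ℂ v) (n l : ℕ) : ‖reflection v n l‖ < 1 :=
  norm_inner_unitResidual_lt_one (window_succ_left v l n)
    (residual_window_ne_zero hv (.inr (by omega))) (residual_window_ne_zero hv (.inr le_rfl))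
    (residual_window_ne_zero hv (.inl l.lt_succ_self))

lemma norm_residual_window (hv : LinearIndependent ℂ v) (n l : ℕ) :
    ‖residual (window v (l + 1) n) (v l)‖ =
      ‖v l‖ * ∏ i ∈ Finset.range n, defect (reflection v i l) := by
  induction n with
  | zero => simp only [window_zero, residual_bot, Finset.range_zero, Finset.prod_empty, mul_one]
  | succ n ih =>
    rw [Finset.prod_range_succ, ← mul_assoc, ← ih, ← defect_conj, conj_reflection]
    exact norm_residual_sup_span_singleton (window_succ_right v (l + 1) n)
      (residual_window_ne_zero hv (.inl l.lt_succ_self)) (residual_window_ne_zero hv (.inr le_rfl))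

lemma forward_shift_eq (hv : LinearIndependent ℂ v) (n l : ℕ) : forward v n (l + 1) =
    reflection v n l • backward v n l + (defect (reflection v n l) : ℂ) • forward v (n + 1) l := by
  have hd : (defect (reflection v n l) : ℂ) ≠ 0 := by
    exact_mod_cast (defect_pos (norm_reflection_lt_one hv n l)).ne'
  rw [forward_succ hv, Complex.ofReal_inv, smul_inv_smul₀ hd, add_sub_cancel]

lemma defect_sq {g : ℂ} (h : ‖g‖ < 1) : (defect g : ℂ) ^ 2 = 1 - g * conj g := by
  rw [Complex.mul_conj, Complex.normSq_eq_norm_sq]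
  exact_mod_cast Real.sq_sqrt (by nlinarith [norm_nonneg g])

lemma backward_succ_eq (hv : LinearIndependent ℂ v) (n l : ℕ) : backward v (n + 1) l =
    (defect (reflection v n l) : ℂ) • backward v n l -
      conj (reflection v n l) • forward v (n + 1) l := by
  have hγ := norm_reflection_lt_one hv n l
  have hd : (defect (reflection v n l) : ℂ) ≠ 0 := by exact_mod_cast (defect_pos hγ).ne'
  rw [← smul_right_inj hd, backward_succ hv, Complex.ofReal_inv, smul_inv_smul₀ hd, smul_sub,
    smul_smul, ← sq, defect_sq hγ, smul_comm, forward_succ hv, Complex.ofReal_inv,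
    smul_inv_smul₀ hd]
  module

/-- The family of parameters of the Gram matrix of `v`. -/
def reflectionFamily (v : ℕ → H) (k j : ℕ) : ℂ :=
  if k < j then reflection v (j - k - 1) k else 0

lemma reflectionFamily_add (v : ℕ → H) (k n : ℕ) :
    reflectionFamily v k (k + n + 1) = reflection v n k := by
  rw [reflectionFamily, if_pos (by omega), show k + n + 1 - k - 1 = n by omega]

lemma vecMul_schurChain_reflectionFamily (hv : LinearIndependent ℂ v) (z : H) {N k n m : ℕ}
    {w : Fin N → ℂ} (hw : ∀ i : Fin N, i ≤ n → w i = inner ℂ z (forward v i k)) (hm : m ≤ n)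
    (hn : n < N) (i : Fin N) (hi : i ≤ n) :
    (w ᵥ* schurChain (reflectionFamily v) N k m) i = inner ℂ z
      (if i < m then forward v i (k + 1) else if i = m then backward v m k else forward v i k) := by
  induction m generalizing i with
  | zero =>
    rw [schurChain, vecMul_one, hw i hi, if_neg (Nat.not_lt_zero _)]
    split_ifs with h
    · rw [h, forward_zero, backward_zero]
    · rfl
  | succ m ih =>
    rw [schurChain, ← vecMul_vecMul, reflectionFamily_add]
    have hm' : m < N := by omega
    have hm'' : m + 1 < N := by omega
    have entry_fst := ih (by omega) ⟨m, hm'⟩ (Nat.le_of_succ_le hm)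
    have entry_snd := ih (by omega) ⟨m + 1, hm''⟩ hm
    rw [if_neg (lt_irrefl m), if_pos rfl] at entry_fst
    rw [if_neg m.not_succ_lt_self, if_neg m.succ_ne_self] at entry_snd
    by_cases h : i.val = m
    · obtain rfl : i = ⟨m, hm'⟩ := Fin.ext h
      rw [vecMul_schurRotation_fst (i := m) _ (b := ⟨m + 1, hm''⟩) rfl rfl, entry_fst, entry_snd,
        if_pos m.lt_succ_self, forward_shift_eq hv, inner_add_right, inner_smul_right,
        inner_smul_right]
      ring
    by_cases h' : i.val = m + 1
    · obtain rfl : i = ⟨m + 1, hm''⟩ := Fin.ext h'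
      rw [vecMul_schurRotation_snd (i := m) _ (a := ⟨m, hm'⟩) rfl rfl, entry_fst, entry_snd,
        if_neg (lt_irrefl _), if_pos rfl, backward_succ_eq hv, inner_sub_right,
        inner_smul_right, inner_smul_right]
      ring
    rw [vecMul_schurRotation_of_ne _ h h', ih (by omega) _ hi, if_neg h, if_neg h']
    exact congrArg _ (if_congr (by omega) rfl rfl)

lemma vecMul_latticeU_reflectionFamily (hv : LinearIndependent ℂ v) (z : H) {N k n : ℕ}
    {w : Fin N → ℂ} (hw : ∀ i : Fin N, i ≤ n → w i = inner ℂ z (forward v i k)) (hn : n < N) :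
    (w ᵥ* latticeU (reflectionFamily v) N k n) ⟨0, by omega⟩ =
      inner ℂ z (forward v 0 (k + n)) := by
  induction n generalizing k w with
  | zero => rw [latticeU, vecMul_one, hw _ le_rfl, add_zero]
  | succ n ih =>
    rw [latticeU, ← vecMul_vecMul, ih (k := k + 1) ?_ (by omega), add_right_comm, add_assoc]
    intro i hi
    rw [vecMul_schurChain_reflectionFamily hv z hw le_rfl hn i (by omega), if_pos (by omega)]

lemma sqrt_gram (v : ℕ → H) (k : ℕ) : Real.sqrt (gram ℂ v k k).re = ‖v k‖ :=
  (norm_eq_sqrt_re_inner (𝕜 := ℂ) (v k)).symm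

theorem isParameterFamily_reflectionFamily (hv : LinearIndependent ℂ v) :
    IsParameterFamily (gram ℂ v) (reflectionFamily v) := by
  refine ⟨fun k j hkj => ?_, fun k j hkj => if_neg (by omega), fun k n => ?_⟩
  · rw [reflectionFamily, if_pos hkj]
    exact norm_reflection_lt_one hv _ _
  have norm_smul_forward (k : ℕ) : v k = (‖v k‖ : ℂ) • forward v 0 k := by
    rw [forward_zero, Complex.ofReal_inv, smul_inv_smul₀]
    exact_mod_cast norm_ne_zero_iff.2 (hv.ne_zero k)
  have first_row (i : Fin (n + 1)) : (Pi.single 0 1 : Fin (n + 1) → ℂ) i =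
      inner ℂ (forward v 0 k) (forward v i k) := by
    rw [orthonormal_iff_ite.1 (forward_orthonormal hv k), Pi.single_apply]
    exact if_congr (Fin.ext_iff.trans eq_comm) rfl rfl
  have lattice := vecMul_latticeU_reflectionFamily hv (forward v 0 k)
    (fun i (_ : (i : ℕ) ≤ n) => first_row i) n.lt_succ_self
  rw [single_one_vecMul] at lattice
  calc gram ℂ v k (k + n)
      = ‖v k‖ * inner ℂ (forward v 0 k) (forward v 0 (k + n)) * ‖v (k + n)‖ := by
        conv_lhs => rw [gram_apply, norm_smul_forward k, norm_smul_forward (k + n),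
          inner_smul_left, inner_smul_right, Complex.conj_ofReal]
        ring
    _ = _ := by
        rw [← lattice, sqrt_gram, sqrt_gram]
        rfl

end Lattice

/-! ### The shifted orthogonal polynomials -/

section Polynomials

variable {K : Matrix ℕ ℕ ℂ} {γ : ℕ → ℕ → ℂ}

lemma orthPoly_zero (K : Matrix ℕ ℕ ℂ) (γ : ℕ → ℕ → ℂ) (l : ℕ) :
    orthPoly K γ 0 l = C (((Real.sqrt (K l l).re)⁻¹ : ℝ) : ℂ) := rfl

lemma orthPolySharp_zero (K : Matrix ℕ ℕ ℂ) (γ : ℕ → ℕ → ℂ) (l : ℕ) :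
    orthPolySharp K γ 0 l = C (((Real.sqrt (K l l).re)⁻¹ : ℝ) : ℂ) := rfl

lemma orthPoly_succ (K : Matrix ℕ ℕ ℂ) (γ : ℕ → ℕ → ℂ) (n l : ℕ) : orthPoly K γ (n + 1) l =
    C (((defect (γ l (l + n + 1)))⁻¹ : ℝ) : ℂ) *
      (X * orthPoly K γ n (l + 1) - C (γ l (l + n + 1)) * orthPolySharp K γ n l) := by
  rw [show l + n + 1 = n + 1 + l by omega]
  rfl

lemma orthPolySharp_succ (K : Matrix ℕ ℕ ℂ) (γ : ℕ → ℕ → ℂ) (n l : ℕ) :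
    orthPolySharp K γ (n + 1) l = C (((defect (γ l (l + n + 1)))⁻¹ : ℝ) : ℂ) *
      (orthPolySharp K γ n l - C (conj (γ l (l + n + 1))) * (X * orthPoly K γ n (l + 1))) := by
  rw [show l + n + 1 = n + 1 + l by omega, sub_eq_neg_add, ← neg_mul, ← mul_assoc]
  rfl

lemma natDegree_orthPoly_le_and_orthPolySharp_le (K : Matrix ℕ ℕ ℂ) (γ : ℕ → ℕ → ℂ) (n l : ℕ) :
    (orthPoly K γ n l).natDegree ≤ n ∧ (orthPolySharp K γ n l).natDegree ≤ n := by
  induction n generalizing l with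
  | zero => simp only [orthPoly_zero, orthPolySharp_zero, natDegree_C, le_refl, and_self]
  | succ n ih =>
    have natDegree_X_mul_le : (X * orthPoly K γ n (l + 1)).natDegree ≤ n + 1 := by
      have := natDegree_mul_le (p := X) (q := orthPoly K γ n (l + 1))
      have := (ih (l + 1)).1
      simp only [natDegree_X] at *
      omega
    have natDegree_sharp_le : (orthPolySharp K γ n l).natDegree ≤ n + 1 :=
      (ih l).2.trans n.le_succ
    have natDegree_C_mul_sub_le {p q : ℂ[X]} (hp : p.natDegree ≤ n + 1) (hq : q.natDegree ≤ n + 1)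
        (a b : ℂ) : (C a * (p - C b * q)).natDegree ≤ n + 1 :=
      (natDegree_C_mul_le _ _).trans <| (natDegree_sub_le_of_le hp
        ((natDegree_C_mul_le _ _).trans hq)).trans (max_self _).le
    rw [orthPoly_succ, orthPolySharp_succ]
    exact ⟨natDegree_C_mul_sub_le natDegree_X_mul_le natDegree_sharp_le _ _,
      natDegree_C_mul_sub_le natDegree_sharp_le natDegree_X_mul_le _ _⟩

lemma coeff_orthPoly_pos (hK : ∀ k, 0 < (K k k).re) (hγ : ∀ k j, k < j → ‖γ k j‖ < 1)
    (n l : ℕ) : 0 < (orthPoly K γ n l).coeff n := by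
  induction n generalizing l with
  | zero =>
    rw [orthPoly_zero, coeff_C_zero]
    exact_mod_cast inv_pos.2 (Real.sqrt_pos.2 (hK l))
  | succ n ih =>
    have coeff_sharp : (orthPolySharp K γ n l).coeff (n + 1) = 0 := coeff_eq_zero_of_natDegree_lt
      (Nat.lt_succ_of_le (natDegree_orthPoly_le_and_orthPolySharp_le K γ n l).2)
    rw [orthPoly_succ, coeff_C_mul, coeff_sub, coeff_X_mul, coeff_C_mul, coeff_sharp, mul_zero,
      sub_zero]
    refine mul_pos ?_ (ih (l + 1))
    exact_mod_cast inv_pos.2 (defect_pos (hγ l _ (by omega)))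

lemma coeff_zero_orthPolySharp_ne_zero (hK : ∀ k, 0 < (K k k).re)
    (hγ : ∀ k j, k < j → ‖γ k j‖ < 1) (n l : ℕ) : (orthPolySharp K γ n l).coeff 0 ≠ 0 := by
  induction n generalizing l with
  | zero =>
    rw [orthPolySharp_zero, coeff_C_zero]
    exact_mod_cast inv_ne_zero (Real.sqrt_pos.2 (hK l)).ne'
  | succ n ih =>
    rw [orthPolySharp_succ, coeff_C_mul, coeff_sub, coeff_C_mul, coeff_X_mul_zero, mul_zero,
      sub_zero]
    refine mul_ne_zero ?_ (ih l)
    exact_mod_cast inv_ne_zero (defect_pos (hγ l _ (by omega))).ne'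

lemma isUnit_arrayPhiSharp (hK : ∀ k, 0 < (K k k).re) (hγ : ∀ k j, k < j → ‖γ k j‖ < 1) (n : ℕ) :
    IsUnit (arrayPhiSharp K γ n) := by
  refine isUnit_of_entry_diag_ne_zero fun k => ?_
  rw [arrayPhiSharp, entry_mkArray, if_pos le_rfl, Nat.sub_self]
  exact coeff_zero_orthPolySharp_ne_zero hK hγ n k

end Polynomials

/-! ### Polynomials as vectors -/

section PolyVec

open Matrix

variable {H : Type*} [NormedAddCommGroup H] [InnerProductSpace ℂ H]

/-- The vector `∑ p_i v (i + l)` represented by the polynomial `∑ p_i X^i`; it carries the form of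
the shifted Gram kernel to the inner product of `H`. -/
def polyVec (v : ℕ → H) (l : ℕ) : ℂ[X] →ₗ[ℂ] H :=
  Polynomial.lsum fun i => LinearMap.toSpanSingleton ℂ H (v (i + l))

lemma polyVec_apply (v : ℕ → H) (l : ℕ) (P : ℂ[X]) :
    polyVec v l P = P.sum fun i a => a • v (i + l) := rfl

lemma polyVec_monomial (v : ℕ → H) (l i : ℕ) (a : ℂ) :
    polyVec v l (monomial i a) = a • v (i + l) := by
  rw [polyVec_apply, sum_monomial_index _ _ (zero_smul ℂ _)]

lemma polyVec_C (v : ℕ → H) (l : ℕ) (a : ℂ) : polyVec v l (C a) = a • v l := by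
  rw [← monomial_zero_left, polyVec_monomial, zero_add]

lemma polyVec_C_mul (v : ℕ → H) (l : ℕ) (a : ℂ) (P : ℂ[X]) :
    polyVec v l (C a * P) = a • polyVec v l P := by
  rw [← smul_eq_C_mul, map_smul]

lemma polyVec_X_mul (v : ℕ → H) (l : ℕ) (P : ℂ[X]) :
    polyVec v l (X * P) = polyVec v (l + 1) P := by
  induction P using Polynomial.induction_on' with
  | add p q hp hq => rw [mul_add, map_add, map_add, hp, hq]
  | monomial i a =>
    rw [X_mul_monomial, polyVec_monomial, polyVec_monomial, add_right_comm, add_assoc]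

lemma inner_polyVec (v : ℕ → H) (l : ℕ) (P Q : ℂ[X]) :
    inner ℂ (polyVec v l Q) (polyVec v l P) = polyInner (shiftKernel (gram ℂ v) l) P Q := by
  simp only [polyVec_apply, polyInner, Polynomial.sum, sum_inner, inner_sum, inner_smul_left,
    inner_smul_right, gram_apply, shiftKernel, of_apply, Finset.mul_sum]
  refine Finset.sum_congr rfl fun i _ => Finset.sum_congr rfl fun j _ => ?_
  ring

variable {v : ℕ → H}

lemma polyVec_orthPoly_and_orthPolySharp (hv : LinearIndependent ℂ v) (n l : ℕ) :
    polyVec v l (orthPoly (gram ℂ v) (reflectionFamily v) n l) = forward v n l ∧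
      polyVec v l (orthPolySharp (gram ℂ v) (reflectionFamily v) n l) = backward v n l := by
  induction n generalizing l with
  | zero =>
    rw [orthPoly_zero, orthPolySharp_zero, forward_zero, backward_zero, polyVec_C, sqrt_gram]
    exact ⟨rfl, rfl⟩
  | succ n ih =>
    rw [orthPoly_succ, orthPolySharp_succ, forward_succ hv, backward_succ hv,
      reflectionFamily_add]
    simp only [polyVec_C_mul, map_sub, polyVec_X_mul, (ih (l + 1)).1, (ih l).2, and_self]

theorem isOrthogonalFamily_orthPoly (hv : LinearIndependent ℂ v) (l : ℕ) :
    IsOrthogonalFamily (shiftKernel (gram ℂ v) l)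
      fun n => orthPoly (gram ℂ v) (reflectionFamily v) n l := by
  have diag_pos (k : ℕ) : 0 < (gram ℂ v k k).re :=
    Real.sqrt_pos.1 (sqrt_gram v k ▸ norm_pos_iff.2 (hv.ne_zero k))
  have coeff_pos := coeff_orthPoly_pos diag_pos (isParameterFamily_reflectionFamily hv).norm_lt_one
  have natDegree_eq (n : ℕ) :
      (orthPoly (gram ℂ v) (reflectionFamily v) n l).natDegree = n :=
    natDegree_eq_of_le_of_coeff_ne_zero (natDegree_orthPoly_le_and_orthPolySharp_le _ _ n l).1
      (coeff_pos n l).ne'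
  refine ⟨natDegree_eq, fun n => ?_, fun n m => ?_⟩
  · rw [leadingCoeff, natDegree_eq]
    exact coeff_pos n l
  · rw [← inner_polyVec, (polyVec_orthPoly_and_orthPolySharp hv n l).1,
      (polyVec_orthPoly_and_orthPolySharp hv m l).1,
      orthonormal_iff_ite.1 (forward_orthonormal hv l)]
    exact if_congr eq_comm rfl rfl

lemma entry_mul_mkArray_coeff {e : ℕ → H} {Θ : LowerArray}
    (hΘ : ∀ k j, entry Θ k j = inner ℂ (e k) (v j)) (p : ℕ → ℂ[X]) (i j : ℕ) :
    entry (Θ * mkArray fun k j => (p j).coeff (k - j)) i j =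
      inner ℂ (e i) (polyVec v j (p j)) := by
  have sum_range : ∑ m ∈ Finset.range (i + 1 - j), (p j).coeff m * entry Θ i (m + j) =
      ∑ m ∈ Finset.range (max ((p j).natDegree + 1) (i + 1 - j)),
        (p j).coeff m * entry Θ i (m + j) := by
    refine Finset.sum_subset (Finset.range_subset_range.2 (le_max_right _ _)) fun m _ hm => ?_
    rw [Finset.mem_range, not_lt] at hm
    rw [entry_of_lt Θ (by omega), mul_zero]
  rw [polyVec_apply, sum_over_range' _ (by simp) _
    (Nat.lt_of_succ_le (le_max_left _ (i + 1 - j))), inner_sum]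
  simp only [inner_smul_right, ← hΘ]
  rw [← sum_range, entry_mul, ← Finset.Ico_add_one_right_eq_Icc, Finset.sum_Ico_eq_sum_range]
  refine Finset.sum_congr rfl fun m _ => ?_
  rw [entry_mkArray, if_pos le_self_add, add_tsub_cancel_left, mul_comm, add_comm]

end PolyVec

/-! ### Innovations -/

section Innovations

open Submodule Matrix

variable {H : Type*} [NormedAddCommGroup H] [InnerProductSpace ℂ H]

/-- The closed span of `v k, v (k + 1), …`. -/
abbrev tailSpan (v : ℕ → H) (k : ℕ) : Submodule ℂ H := (span ℂ (v '' Set.Ici k)).topologicalClosure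

variable {v : ℕ → H}

lemma tailSpan_antitone (v : ℕ → H) : Antitone (tailSpan v) := fun _ _ h =>
  topologicalClosure_mono (span_mono (Set.image_mono (Set.Ici_subset_Ici.2 h)))

lemma mem_tailSpan (v : ℕ → H) {k j : ℕ} (h : k ≤ j) : v j ∈ tailSpan v k :=
  le_topologicalClosure _ (subset_span ⟨j, h, rfl⟩)

lemma tailSpan_eq_sup (v : ℕ → H) (k : ℕ) : tailSpan v k = tailSpan v (k + 1) ⊔ ℂ ∙ v k := by
  refine le_antisymm (topologicalClosure_minimal _ ?_ ?_)
    (sup_le (tailSpan_antitone v k.le_succ) ?_)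
  · rw [span_le]
    rintro _ ⟨j, hj, rfl⟩
    obtain rfl | hj := (Set.mem_Ici.1 hj).eq_or_lt
    · exact mem_sup_right (mem_span_singleton_self _)
    · exact mem_sup_left (mem_tailSpan v hj)
  · exact isClosed_sup_finiteDimensional _ _ (isClosed_topologicalClosure _)
  · exact (span_singleton_le_iff_mem _ _).2 (mem_tailSpan v le_rfl)

lemma map_mem_tailSpan {H' : Type*} [NormedAddCommGroup H'] [InnerProductSpace ℂ H']
    (A : H →L[ℂ] H') {k : ℕ} {x : H} (hx : x ∈ tailSpan v k) :
    A x ∈ tailSpan (fun j => A (v j)) k := by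
  have map_mem := (span ℂ (v '' Set.Ici k)).topologicalClosure_map A (mem_map_of_mem hx)
  rwa [map_span, ← Set.image_comp] at map_mem

lemma iSup_window (v : ℕ → H) (k : ℕ) : ⨆ n, window v k n = span ℂ (v '' Set.Ici k) := by
  simp only [window, ← span_iUnion, ← Set.image_iUnion]
  congr 2
  ext i
  simp only [Set.mem_iUnion, Set.mem_Ico, Set.mem_Ici]
  exact ⟨fun ⟨_, h, _⟩ => h, fun h => ⟨i + 1, h, by omega⟩⟩

variable {H' : Type*} [NormedAddCommGroup H'] [InnerProductSpace ℂ H'] {v' : ℕ → H'}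

lemma inner_sub_linearCombination_congr (h : gram ℂ v = gram ℂ v') (x : ℕ →₀ ℂ) (k j : ℕ) :
    inner ℂ (v k - Finsupp.linearCombination ℂ v x) (v j) =
      inner ℂ (v' k - Finsupp.linearCombination ℂ v' x) (v' j) := by
  simp only [inner_sub_left, Finsupp.linearCombination_apply, Finsupp.sum, sum_inner,
    inner_smul_left, ← gram_apply, h]

lemma inner_residual_window_congr (h : gram ℂ v = gram ℂ v') (i n k j : ℕ) :
    inner ℂ (residual (window v i n) (v k)) (v j) =
      inner ℂ (residual (window v' i n) (v' k)) (v' j) := by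
  obtain ⟨x, hx, hxv⟩ := (Finsupp.mem_span_image_iff_linearCombination ℂ).1
    ((window v i n).starProjection_apply_mem (v k))
  have projection_eq :
      (window v' i n).starProjection (v' k) = Finsupp.linearCombination ℂ v' x := by
    refine eq_starProjection_of_mem_orthogonal
      ((Finsupp.mem_span_image_iff_linearCombination ℂ).2 ⟨x, hx, rfl⟩) ?_
    rw [← span_singleton_le_iff_mem, le_orthogonal_iff_le_orthogonal, window, span_le]
    rintro _ ⟨l, hl, rfl⟩
    rw [SetLike.mem_coe, mem_orthogonal_singleton_iff_inner_right,
      ← inner_sub_linearCombination_congr h, hxv]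
    exact starProjection_inner_eq_zero _ _ (subset_span ⟨l, hl, rfl⟩)
  simp only [starProjection_orthogonal_val]
  rw [projection_eq, ← hxv, inner_sub_linearCombination_congr h]

variable [CompleteSpace H]

/-- The residual of `v k` modulo all later vectors. -/
def innovation (v : ℕ → H) (k : ℕ) : H := residual (tailSpan v (k + 1)) (v k)

/-- The normalized innovation; it is `0` if the innovation vanishes. -/
def unitInnovation (v : ℕ → H) (k : ℕ) : H := unitResidual (tailSpan v (k + 1)) (v k)

lemma tendsto_residual_window (v : ℕ → H) (k : ℕ) (x : H) :
    Tendsto (fun n => residual (window v k n) x) atTop (𝓝 (residual (tailSpan v k) x)) := by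
  have window_monotone : Monotone (window v k) := fun _ _ h => window_mono le_rfl (by omega)
  have := starProjection_tendsto_closure_iSup _ window_monotone x
  simp only [starProjection_orthogonal_val, iSup_window] at this ⊢
  exact tendsto_const_nhds.sub this

lemma unitInnovation_eq_zero {k : ℕ} (h : innovation v k = 0) : unitInnovation v k = 0 := by
  rw [unitInnovation, unitResidual, ← innovation, h, smul_zero]

lemma norm_unitInnovation {k : ℕ} (h : innovation v k ≠ 0) : ‖unitInnovation v k‖ = 1 :=
  norm_unitResidual h

lemma unitInnovation_mem_tailSpan (v : ℕ → H) (k : ℕ) : unitInnovation v k ∈ tailSpan v k :=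
  unitResidual_mem (tailSpan_antitone v k.le_succ) (mem_tailSpan v le_rfl)

lemma inner_unitInnovation_of_mem {k : ℕ} {x : H} (hx : x ∈ tailSpan v (k + 1)) :
    inner ℂ (unitInnovation v k) x = 0 :=
  inner_left_of_mem_orthogonal hx (unitResidual_mem_orthogonal _ _)

lemma inner_unitInnovation_of_lt (v : ℕ → H) {k j : ℕ} (h : k < j) :
    inner ℂ (unitInnovation v k) (v j) = 0 :=
  inner_unitInnovation_of_mem (mem_tailSpan v h)

lemma inner_unitInnovation_self (v : ℕ → H) (k : ℕ) :
    inner ℂ (unitInnovation v k) (v k) = ‖innovation v k‖ := by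
  rw [unitInnovation, inner_unitResidual, ← innovation, inner_self_eq_norm_sq_to_K]
  obtain h | h := eq_or_ne (innovation v k) 0
  · rw [h, norm_zero, Complex.ofReal_zero, zero_mul]
  · rw [norm_unitResidual h, RCLike.ofReal_one, one_pow, mul_one]

lemma inner_unitInnovation_unitInnovation (v : ℕ → H) {i j : ℕ} (h : i ≠ j) :
    inner ℂ (unitInnovation v i) (unitInnovation v j) = 0 := by
  have inner_eq_zero {i j : ℕ} (hij : i < j) :
      inner ℂ (unitInnovation v i) (unitInnovation v j) = 0 :=
    inner_unitInnovation_of_mem (tailSpan_antitone v hij (unitInnovation_mem_tailSpan v j))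
  obtain h | h := h.lt_or_gt
  · exact inner_eq_zero h
  · exact inner_eq_zero_symm.1 (inner_eq_zero h)

lemma mem_tailSpan_succ {k : ℕ} {x : H} (hx : x ∈ tailSpan v k)
    (h : inner ℂ (unitInnovation v k) x = 0) : x ∈ tailSpan v (k + 1) :=
  mem_of_mem_sup_span_singleton (tailSpan_eq_sup v k) hx h

theorem inner_innovation_congr [CompleteSpace H'] (h : gram ℂ v = gram ℂ v') (k j : ℕ) :
    inner ℂ (innovation v k) (v j) = inner ℂ (innovation v' k) (v' j) := by
  refine tendsto_nhds_unique
    ((tendsto_residual_window v (k + 1) (v k)).inner tendsto_const_nhds) ?_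
  simp only [inner_residual_window_congr h]
  exact (tendsto_residual_window v' (k + 1) (v' k)).inner tendsto_const_nhds

lemma norm_innovation_congr [CompleteSpace H'] (h : gram ℂ v = gram ℂ v') (k : ℕ) :
    ‖innovation v k‖ = ‖innovation v' k‖ := by
  have inner_self := inner_innovation_congr h k k
  rw [innovation, innovation, inner_residual_left, inner_residual_left _ (v' k),
    inner_self_eq_norm_sq_to_K, inner_self_eq_norm_sq_to_K] at inner_self
  exact (sq_eq_sq₀ (norm_nonneg _) (norm_nonneg _)).1 (by exact_mod_cast inner_self)

lemma inner_unitInnovation_congr [CompleteSpace H'] (h : gram ℂ v = gram ℂ v') (k j : ℕ) :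
    inner ℂ (unitInnovation v k) (v j) = inner ℂ (unitInnovation v' k) (v' j) := by
  rw [unitInnovation, unitInnovation, unitResidual, unitResidual, inner_smul_left,
    inner_smul_left]
  exact congrArg₂ (fun r z => conj ((r⁻¹ : ℝ) : ℂ) * z) (norm_innovation_congr h k)
    (inner_innovation_congr h k j)

/-- The array `⟪e_k, v_j⟫` of coefficients along the normalized innovations `e_k`. It turns out to
be the normalized spectral factor of the Gram matrix of `v`. -/
def factorArray (v : ℕ → H) : LowerArray := mkArray fun k j => inner ℂ (unitInnovation v k) (v j)

lemma entry_factorArray (v : ℕ → H) (k j : ℕ) :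
    entry (factorArray v) k j = inner ℂ (unitInnovation v k) (v j) := by
  rw [factorArray, entry_mkArray]
  split_ifs with h
  · rfl
  · rw [inner_unitInnovation_of_lt v (not_le.1 h)]

lemma entry_factorArray_self (v : ℕ → H) (k : ℕ) :
    entry (factorArray v) k k = ‖innovation v k‖ := by
  rw [entry_factorArray, inner_unitInnovation_self]

lemma factorArray_congr [CompleteSpace H'] (h : gram ℂ v = gram ℂ v') :
    factorArray v = factorArray v' :=
  entry_ext fun k j => by rw [entry_factorArray, entry_factorArray, inner_unitInnovation_congr h]

end Innovations

/-! ### Outer arrays -/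

section Outer

open Submodule

variable {F : ℕ → Type*} [∀ n, NormedAddCommGroup (F n)] [∀ n, InnerProductSpace ℂ (F n)]
  {c : ℕ → lp F 2}

lemma isOuter_iff : IsOuter c ↔ ∀ k x, x ∈ tailSpan c k ↔ ∀ i < k, x i = 0 := by
  have image_Ici (k : ℕ) : {x | ∃ j, k ≤ j ∧ x = c j} = c '' Set.Ici k := by
    ext x
    simp only [Set.mem_ofPred_eq, Set.mem_image, Set.mem_Ici, eq_comm]
  simp only [IsOuter, image_Ici, ← topologicalClosure_coe, Set.ext_iff, SetLike.mem_coe,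
    Set.mem_ofPred_eq]

lemma IsLowerTriangular.apply_eq_zero (hc : IsLowerTriangular c) {k i : ℕ} (hi : i < k)
    {x : lp F 2} (hx : x ∈ tailSpan c k) : x i = 0 := by
  have tailSpan_le_ker : tailSpan c k ≤ (lp.evalCLM ℂ F 2 i).ker := by
    refine topologicalClosure_minimal _ (span_le.2 ?_) (lp.evalCLM ℂ F 2 i).isClosed_ker
    rintro _ ⟨j, hj, rfl⟩
    exact hc j i (hi.trans_le hj)
  exact tailSpan_le_ker hx

variable [∀ n, CompleteSpace (F n)]

lemma IsOuter.innovation_eq (h : IsOuter c) (hc : IsLowerTriangular c) (k : ℕ) :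
    innovation c k = lp.single 2 k (c k k) := by
  have mem_iff := isOuter_iff.1 h (k + 1)
  refine eq_starProjection_of_mem_orthogonal ?_ (le_orthogonal_orthogonal _ ?_)
  · refine (mem_orthogonal' _ _).2 fun w hw => ?_
    rw [lp.inner_single_left, (mem_iff w).1 hw k k.lt_succ_self, inner_zero_right]
  · refine (mem_iff _).2 fun i hi => ?_
    rw [lp.coeFn_sub, Pi.sub_apply]
    obtain rfl | hi := (Nat.lt_succ_iff.1 hi).eq_or_lt
    · rw [lp.single_apply_self, sub_self]
    · rw [hc k i hi, lp.single_apply_ne _ _ _ hi.ne, sub_zero]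

lemma IsOuter.eq_zero_of_innovation_eq_zero (h : IsOuter c) {k : ℕ} (hk : innovation c k = 0)
    (a : F k) : a = 0 := by
  have single_mem : lp.single 2 k a ∈ tailSpan c k :=
    (isOuter_iff.1 h k _).2 fun i hi => lp.single_apply_ne _ _ _ hi.ne
  have inner_eq_zero : inner ℂ (unitInnovation c k) (lp.single 2 k a) = 0 := by
    rw [unitInnovation_eq_zero hk, inner_zero_left]
  rw [← lp.single_apply_self 2 k a]
  exact (isOuter_iff.1 h _ _).1 (mem_tailSpan_succ single_mem inner_eq_zero) k k.lt_succ_self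

end Outer

lemma IsOuter.inner_unitInnovation {F : ℕ → Submodule ℂ ℂ} {c : ℕ → lp (fun n => F n) 2}
    (h : IsOuter c) (hc : IsLowerTriangular c) {k : ℕ} (hk : 0 ≤ (c k k : ℂ)) (j : ℕ) :
    inner ℂ (unitInnovation c k) (c j) = (c j k : ℂ) := by
  obtain h₀ | h₀ := eq_or_ne (innovation c k) 0
  · rw [h.eq_zero_of_innovation_eq_zero h₀ (c j k), unitInnovation_eq_zero h₀, inner_zero_left,
      Submodule.coe_zero]
  have innovation_eq := h.innovation_eq hc k
  have norm_innovation : (‖innovation c k‖ : ℂ) = c k k := by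
    rw [innovation_eq, lp.norm_single two_pos, Submodule.coe_norm, Complex.norm_of_nonneg' hk]
  have diag_ne_zero : (c k k : ℂ) ≠ 0 := by
    rw [← norm_innovation]
    exact_mod_cast norm_ne_zero_iff.2 h₀
  rw [unitInnovation, unitResidual, ← innovation, inner_smul_left, Complex.conj_ofReal,
    Complex.ofReal_inv, norm_innovation, innovation_eq, lp.inner_single_left, Submodule.coe_inner,
    RCLike.inner_apply, (Complex.conj_eq_iff_im).2 (Complex.nonneg_iff.1 hk).2.symm,
    mul_comm (c j k : ℂ), inv_mul_cancel_left₀ diag_ne_zero]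

lemma IsSpectralFactor.unique {K : Matrix ℕ ℕ ℂ} {Θ Θ' : LowerArray} (h : IsSpectralFactor K Θ)
    (h' : IsSpectralFactor K Θ') : Θ = Θ' := by
  have eq_factorArray {F : ℕ → Submodule ℂ ℂ} {c : ℕ → lp (fun n => F n) 2} {Θ : LowerArray}
      (hc : IsMaximalOuter K c) (hΘ : ∀ k j, entry Θ k j = c j k)
      (hpos : ∀ n, 0 ≤ entry Θ n n) : Θ = factorArray c := entry_ext fun k j => by
    rw [entry_factorArray, hc.outer.inner_unitInnovation hc.lower (hΘ k k ▸ hpos k), hΘ]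
  obtain ⟨F, c, hc, hΘ, hpos⟩ := h
  obtain ⟨F', c', hc', hΘ', hpos'⟩ := h'
  have gram_eq : Matrix.gram ℂ c = Matrix.gram ℂ c' :=
    (hc'.maximal _ c hc.lower hc.outer hc.le).antisymm
      (hc.maximal _ c' hc'.lower hc'.outer hc'.le)
  rw [eq_factorArray hc hΘ hpos, eq_factorArray hc' hΘ' hpos', factorArray_congr gram_eq]

/-! ### The spectral factor of a Gram matrix -/

open Submodule in
lemma exists_continuousLinearMap_apply_eq {ι 𝕜 H H' : Type*} [RCLike 𝕜]
    [NormedAddCommGroup H] [InnerProductSpace 𝕜 H] [CompleteSpace H]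
    [NormedAddCommGroup H'] [InnerProductSpace 𝕜 H'] [CompleteSpace H'] {v : ι → H} {w : ι → H'}
    (h : ∀ x, ‖Finsupp.linearCombination 𝕜 w x‖ ≤ ‖Finsupp.linearCombination 𝕜 v x‖) :
    ∃ T : H →L[𝕜] H', (∀ i, T (v i) = w i) ∧ ∀ x, ‖T x‖ ≤ ‖x‖ := by
  let W := (LinearMap.range (Finsupp.linearCombination 𝕜 v)).topologicalClosure
  have le_W : LinearMap.range (Finsupp.linearCombination 𝕜 v) ≤ W := le_topologicalClosure _
  let e : (ι →₀ 𝕜) →ₗ[𝕜] W :=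
    (Finsupp.linearCombination 𝕜 v).codRestrict W fun x => le_W ⟨x, rfl⟩
  have denseRange_e : DenseRange e := by
    rw [DenseRange, Topology.IsInducing.subtypeVal.dense_iff]
    intro x
    rw [← Set.range_comp]
    exact x.2
  have norm_le : ∀ x, ‖Finsupp.linearCombination 𝕜 w x‖ ≤ 1 * ‖e x‖ := fun x =>
    (h x).trans_eq (one_mul _).symm
  have mem_W (i : ι) : v i ∈ W := le_W ⟨Finsupp.single i 1, by simp⟩
  have e_single (i : ι) : e (Finsupp.single i 1) = ⟨v i, mem_W i⟩ := Subtype.ext (by simp [e])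
  let T := (Finsupp.linearCombination 𝕜 w).extendOfNorm e
  refine ⟨T ∘L W.orthogonalProjectionOnto, fun i => ?_, fun x => ?_⟩
  · have := LinearMap.extendOfNorm_eq denseRange_e ⟨1, norm_le⟩ (Finsupp.single i 1)
    rw [ContinuousLinearMap.comp_apply,
      orthogonalProjectionOnto_mem_subspace_eq_self ⟨v i, mem_W i⟩, ← e_single]
    simpa using this
  · refine (LinearMap.norm_extendOfNorm_apply_le denseRange_e 1 norm_le _).trans ?_
    rw [one_mul]
    exact W.norm_orthogonalProjectionOnto_apply_le x

section Existence

open Submodule Matrix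

variable {H : Type*} [NormedAddCommGroup H] [InnerProductSpace ℂ H] [CompleteSpace H]

/-- The space of the `k`-th row of the spectral factor, as a subspace of `ℂ`: it is trivial if the
innovation vanishes and `ℂ` otherwise. -/
def innovationSpace (v : ℕ → H) (k : ℕ) : Submodule ℂ ℂ := ℂ ∙ (‖innovation v k‖ : ℂ)

lemma eq_zero_of_mem_innovationSpace {v : ℕ → H} {k : ℕ} (h : innovation v k = 0)
    (z : innovationSpace v k) : (z : ℂ) = 0 := by
  simpa [innovationSpace, h] using z.2

/-- The isometric embedding `z ↦ z • e_k` along the normalized innovation `e_k`. -/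
def innovationEmbedding (v : ℕ → H) (k : ℕ) : innovationSpace v k →ₗᵢ[ℂ] H where
  toLinearMap := (LinearMap.toSpanSingleton ℂ H (unitInnovation v k)).comp
    (innovationSpace v k).subtype
  norm_map' z := by
    change ‖(z : ℂ) • unitInnovation v k‖ = ‖(z : ℂ)‖
    obtain h | h := eq_or_ne (innovation v k) 0
    · rw [eq_zero_of_mem_innovationSpace h z, zero_smul, norm_zero, norm_zero]
    · rw [norm_smul, norm_unitInnovation h, mul_one]

lemma innovationEmbedding_apply (v : ℕ → H) (k : ℕ) (z : innovationSpace v k) :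
    innovationEmbedding v k z = (z : ℂ) • unitInnovation v k := rfl

lemma orthogonalFamily_innovationEmbedding (v : ℕ → H) :
    OrthogonalFamily ℂ (fun k => innovationSpace v k) (innovationEmbedding v) := by
  intro i j hij x y
  rw [innovationEmbedding_apply, innovationEmbedding_apply, inner_smul_left, inner_smul_right,
    inner_unitInnovation_unitInnovation v hij, mul_zero, mul_zero]

/-- The synthesis operator `x ↦ ∑ x_k e_k` of the normalized innovations `e_k`. -/
def synthesis (v : ℕ → H) : lp (fun k => innovationSpace v k) 2 →ₗᵢ[ℂ] H :=
  (orthogonalFamily_innovationEmbedding v).linearIsometry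

/-- The analysis operator `y ↦ (⟪e_k, y⟫)_k` of the normalized innovations `e_k`. -/
def analysis (v : ℕ → H) : H →L[ℂ] lp (fun k => innovationSpace v k) 2 :=
  ContinuousLinearMap.adjoint (synthesis v).toContinuousLinearMap

lemma inner_analysis (v : ℕ → H) (x : lp (fun k => innovationSpace v k) 2) (y : H) :
    inner ℂ x (analysis v y) = inner ℂ (synthesis v x) y :=
  ContinuousLinearMap.adjoint_inner_right _ _ _

lemma analysis_synthesis (v : ℕ → H) (x : lp (fun k => innovationSpace v k) 2) :
    analysis v (synthesis v x) = x :=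
  ext_inner_left ℂ fun y => by rw [inner_analysis, LinearIsometry.inner_map_map]

lemma norm_analysis_le (v : ℕ → H) (y : H) : ‖analysis v y‖ ≤ ‖y‖ := by
  have opNorm_le : ‖analysis v‖ ≤ 1 := by
    rw [analysis, LinearIsometryEquiv.norm_map]
    exact (synthesis v).norm_toContinuousLinearMap_le
  simpa only [one_mul] using (analysis v).le_of_opNorm_le opNorm_le y

lemma coe_analysis_apply (v : ℕ → H) (y : H) (k : ℕ) :
    ((analysis v y k : innovationSpace v k) : ℂ) = inner ℂ (unitInnovation v k) y := by
  obtain h | h := eq_or_ne (innovation v k) 0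
  · rw [eq_zero_of_mem_innovationSpace h, unitInnovation_eq_zero h, inner_zero_left]
  let r : innovationSpace v k := ⟨‖innovation v k‖, mem_span_singleton_self _⟩
  have r_ne_zero : conj (r : ℂ) ≠ 0 := by simpa [r] using h
  refine mul_left_cancel₀ r_ne_zero ?_
  have := inner_analysis v (lp.single 2 k r) y
  rwa [lp.inner_single_left, synthesis, OrthogonalFamily.linearIsometry_apply_single,
    innovationEmbedding_apply, Submodule.coe_inner, RCLike.inner_apply, inner_smul_left,
    mul_comm] at this

lemma synthesis_mem_tailSpan (v : ℕ → H) {k : ℕ} {x : lp (fun k => innovationSpace v k) 2}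
    (hx : ∀ i < k, x i = 0) : synthesis v x ∈ tailSpan v k := by
  refine (isClosed_topologicalClosure _).mem_of_tendsto
    ((orthogonalFamily_innovationEmbedding v).hasSum_linearIsometry x)
    (.of_forall fun s => sum_mem fun i _ => ?_)
  rw [innovationEmbedding_apply]
  obtain hi | hi := lt_or_ge i k
  · rw [hx i hi, ZeroMemClass.coe_zero, zero_smul]
    exact zero_mem _
  · exact smul_mem _ _ (tailSpan_antitone v hi (unitInnovation_mem_tailSpan v i))

lemma sub_synthesis_analysis_mem_tailSpan (v : ℕ → H) {y : H} (hy : y ∈ tailSpan v 0) (k : ℕ) :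
    y - synthesis v (analysis v y) ∈ tailSpan v k := by
  induction k with
  | zero => exact sub_mem hy (synthesis_mem_tailSpan v fun i hi => absurd hi i.not_lt_zero)
  | succ k ih =>
    refine mem_tailSpan_succ ih ?_
    rw [← coe_analysis_apply, map_sub, analysis_synthesis, sub_self]
    rfl

/-- The columns `(⟪e_k, v_j⟫)_k` of the spectral factor of the Gram matrix of `v`. -/
def factorColumn (v : ℕ → H) (j : ℕ) : lp (fun k => innovationSpace v k) 2 := analysis v (v j)

lemma linearCombination_factorColumn (v : ℕ → H) (x : ℕ →₀ ℂ) :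
    Finsupp.linearCombination ℂ (factorColumn v) x =
      analysis v (Finsupp.linearCombination ℂ v x) :=
  (Finsupp.apply_linearCombination ℂ (analysis v).toLinearMap v x).symm

lemma isLowerTriangular_factorColumn (v : ℕ → H) : IsLowerTriangular (factorColumn v) :=
  fun j k h => by
    rw [← Submodule.coe_eq_zero, factorColumn, coe_analysis_apply, inner_unitInnovation_of_lt v h]

lemma isOuter_factorColumn (v : ℕ → H) : IsOuter (factorColumn v) := by
  refine isOuter_iff.2 fun k x =>
    ⟨fun hx i hi => (isLowerTriangular_factorColumn v).apply_eq_zero hi hx, fun hx => ?_⟩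
  rw [← analysis_synthesis v x]
  exact map_mem_tailSpan (analysis v) (synthesis_mem_tailSpan v hx)

lemma norm_apply_le_norm_analysis {F : ℕ → Type*} [∀ n, NormedAddCommGroup (F n)]
    [∀ n, InnerProductSpace ℂ (F n)] {v : ℕ → H} {T : H →L[ℂ] lp F 2} (hT : ∀ x, ‖T x‖ ≤ ‖x‖)
    (hTv : IsLowerTriangular fun j => T (v j)) {y : H} (hy : y ∈ tailSpan v 0) :
    ‖T y‖ ≤ ‖analysis v y‖ := by
  -- The remainder of the expansion of `y` lies in every tail, so that `T` maps it to `0`.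
  have map_remainder : T (y - synthesis v (analysis v y)) = 0 := lp.ext <| funext fun i =>
    hTv.apply_eq_zero i.lt_succ_self
      (map_mem_tailSpan T (sub_synthesis_analysis_mem_tailSpan v hy (i + 1)))
  rw [map_sub, sub_eq_zero] at map_remainder
  rw [map_remainder, ← (synthesis v).norm_map (analysis v y)]
  exact hT _

theorem isMaximalOuter_factorColumn (v : ℕ → H) : IsMaximalOuter (gram ℂ v) (factorColumn v) where
  lower := isLowerTriangular_factorColumn v
  outer := isOuter_factorColumn v
  le := posSemidef_gram_sub_gram_iff.2 fun x => by
    rw [linearCombination_factorColumn]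
    exact norm_analysis_le v _
  maximal F' _ _ _ c' lower _ le := by
    obtain ⟨T, hTv, hT⟩ :=
      exists_continuousLinearMap_apply_eq (posSemidef_gram_sub_gram_iff.1 le)
    refine posSemidef_gram_sub_gram_iff.2 fun x => ?_
    obtain rfl : (fun j => T (v j)) = c' := funext hTv
    have linearCombination_mem : Finsupp.linearCombination ℂ v x ∈ tailSpan v 0 := by
      rw [Finsupp.linearCombination_apply]
      exact sum_mem fun j _ => smul_mem _ _ (mem_tailSpan v j.zero_le)
    rw [linearCombination_factorColumn]
    refine le_of_eq_of_le (congrArg norm ?_)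
      (norm_apply_le_norm_analysis hT lower linearCombination_mem)
    exact (Finsupp.apply_linearCombination ℂ T.toLinearMap v x).symm

theorem isSpectralFactor_factorArray (v : ℕ → H) :
    IsSpectralFactor (gram ℂ v) (factorArray v) := by
  refine ⟨innovationSpace v, factorColumn v, isMaximalOuter_factorColumn v, fun k j => ?_,
    fun n => ?_⟩
  · rw [entry_factorArray, factorColumn, coe_analysis_apply]
  · rw [entry_factorArray_self]
    exact_mod_cast norm_nonneg _

theorem isSzegoClass_gram_iff {v : ℕ → H} :
    IsSzegoClass (gram ℂ v) ↔ ∀ k, innovation v k ≠ 0 := by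
  have diag_pos_iff : (∀ n, 0 < entry (factorArray v) n n) ↔ ∀ k, innovation v k ≠ 0 := by
    simp only [entry_factorArray_self, Complex.zero_lt_real, norm_pos_iff]
  rw [← diag_pos_iff]
  refine ⟨fun ⟨Θ, hΘ, h⟩ => ?_, fun h => ⟨_, isSpectralFactor_factorArray v, h⟩⟩
  rwa [hΘ.unique (isSpectralFactor_factorArray v)] at h

end Existence

/-! ### Limits -/

section Limits

open Matrix

variable {H : Type*} [NormedAddCommGroup H] [InnerProductSpace ℂ H] {v : ℕ → H}

lemma tendsto_inner_forward (hv : LinearIndependent ℂ v) (x : H) (l : ℕ) :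
    Tendsto (fun n => inner ℂ x (forward v n l)) atTop (𝓝 0) := by
  have summable_sq := (forward_orthonormal hv l).inner_products_summable x
  have norm_tendsto : Tendsto (fun n => ‖inner ℂ (forward v n l) x‖) atTop (𝓝 0) := by
    simpa only [Real.sqrt_sq (norm_nonneg _), Real.sqrt_zero] using
      summable_sq.tendsto_atTop_zero.sqrt
  exact tendsto_zero_iff_norm_tendsto_zero.2 (by simpa only [norm_inner_symm x] using norm_tendsto)

lemma prod_Ioc_defect_reflectionFamily (v : ℕ → H) (k n : ℕ) :
    ∏ j ∈ Finset.Ioc k (k + n), defect (reflectionFamily v k j) =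
      ∏ i ∈ Finset.range n, defect (reflection v i k) := by
  induction n with
  | zero => simp
  | succ n ih =>
    rw [← add_assoc, Finset.prod_Ioc_succ_top (Nat.le_add_right k n), ih, Finset.prod_range_succ,
      reflectionFamily_add]

variable [CompleteSpace H]

lemma tendsto_backward {k : ℕ} (hk : innovation v k ≠ 0) :
    Tendsto (fun n => backward v n k) atTop (𝓝 (unitInnovation v k)) := by
  have residual_tendsto := tendsto_residual_window v (k + 1) (v k)
  have inv_norm_tendsto := residual_tendsto.norm.inv₀ (norm_ne_zero_iff.2 hk)
  exact ((Complex.continuous_ofReal.tendsto _).comp inv_norm_tendsto).smul residual_tendsto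

theorem hasPositiveProducts_gram_iff (hv : LinearIndependent ℂ v) :
    HasPositiveProducts (gram ℂ v) (reflectionFamily v) ↔ ∀ k, innovation v k ≠ 0 := by
  refine forall_congr' fun k => ?_
  have norm_v_pos : 0 < ‖v k‖ := norm_pos_iff.2 (hv.ne_zero k)
  have product_tendsto : Tendsto (fun m => (gram ℂ v k k).re *
      ∏ n ∈ Finset.Ioc k m, defect (reflectionFamily v k n)) atTop
      (𝓝 (‖v k‖ * ‖innovation v k‖)) := by
    rw [← tendsto_add_atTop_iff_nat k]
    refine ((tendsto_residual_window v (k + 1) (v k)).norm.const_mul ‖v k‖).congr fun n => ?_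
    have re_gram : (gram ℂ v k k).re = ‖v k‖ * ‖v k‖ := by
      rw [gram_apply, ← inner_self_eq_norm_mul_norm (𝕜 := ℂ)]
      rfl
    rw [norm_residual_window hv, add_comm n, prod_Ioc_defect_reflectionFamily, re_gram, mul_assoc]
  refine ⟨fun ⟨g, g_pos, hg⟩ h => g_pos.ne' ?_,
    fun h => ⟨_, mul_pos norm_v_pos (norm_pos_iff.2 h), product_tendsto⟩⟩
  rw [tendsto_nhds_unique hg product_tendsto, h, norm_zero, mul_zero]

theorem convergesTo_arrayPhi (hv : LinearIndependent ℂ v) (h : ∀ k, innovation v k ≠ 0) :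
    ConvergesTo (arrayPhi (gram ℂ v) (reflectionFamily v)) 0 := by
  have entry_diag_ne_zero (k : ℕ) : entry (factorArray v) k k ≠ 0 := by
    rw [entry_factorArray_self]
    exact_mod_cast norm_ne_zero_iff.2 (h k)
  refine ConvergesTo.of_mul_left (b := fun _ => factorArray v) (fun _ _ => tendsto_const_nhds)
    entry_diag_ne_zero fun i j => ?_
  simp only [mul_zero, entry_zero, arrayPhi, entry_mul_mkArray_coeff (entry_factorArray v),
    (polyVec_orthPoly_and_orthPolySharp hv _ j).1]
  exact tendsto_inner_forward hv _ j

theorem convergesTo_factorArray_mul_arrayPhiSharp (hv : LinearIndependent ℂ v)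
    (h : ∀ k, innovation v k ≠ 0) :
    ConvergesTo (fun n => factorArray v * arrayPhiSharp (gram ℂ v) (reflectionFamily v) n) 1 := by
  intro i j
  have inner_tendsto : Tendsto (fun n => inner ℂ (unitInnovation v i) (backward v n j)) atTop
      (𝓝 (inner ℂ (unitInnovation v i) (unitInnovation v j))) :=
    tendsto_const_nhds.inner (tendsto_backward (h j))
  have inner_eq : inner ℂ (unitInnovation v i) (unitInnovation v j) = entry 1 i j := by
    rw [entry_one]
    split_ifs with hij
    · rw [hij, inner_self_eq_norm_sq_to_K, norm_unitInnovation (h j), RCLike.ofReal_one, one_pow]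
    · exact inner_unitInnovation_unitInnovation v hij
  rw [inner_eq] at inner_tendsto
  simpa only [arrayPhiSharp, entry_mul_mkArray_coeff (entry_factorArray v),
    (polyVec_orthPoly_and_orthPolySharp hv _ j).2] using inner_tendsto

theorem convergesTo_inverse_arrayPhiSharp (hv : LinearIndependent ℂ v)
    (h : ∀ k, innovation v k ≠ 0)
    (isUnit : ∀ n, IsUnit (arrayPhiSharp (gram ℂ v) (reflectionFamily v) n)) :
    ConvergesTo (fun n => Ring.inverse (arrayPhiSharp (gram ℂ v) (reflectionFamily v) n))
      (factorArray v) := by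
  refine (convergesTo_factorArray_mul_arrayPhiSharp hv h).of_mul_left
    (fun k => by simp [entry_one]) ?_
  simp only [mul_assoc, Ring.mul_inverse_cancel _ (isUnit _), mul_one, one_mul]
  exact fun _ _ => tendsto_const_nhds

end Limits

end

end SzegoArrays

theorem theorem3p3_general {K : Matrix ℕ ℕ ℂ} (hK : K.PosDef) :
    (∃! γ, IsParameterFamily K γ) ∧ (∃! Θ, IsSpectralFactor K Θ) ∧
    ∀ γ, IsParameterFamily K γ →
      (∀ l, IsOrthogonalFamily (shiftKernel K l) fun n => orthPoly K γ n l) ∧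
      (∀ n, IsUnit (arrayPhiSharp K γ n)) ∧
      (IsSzegoClass K ↔ HasPositiveProducts K γ) ∧
      (IsSzegoClass K → ConvergesTo (arrayPhi K γ) 0 ∧
        ∀ Θ, IsSpectralFactor K Θ →
          ConvergesTo (fun n => Ring.inverse (arrayPhiSharp K γ n)) Θ) := by
  obtain ⟨H, _, _, _, v, rfl⟩ := exists_gram_eq hK.posSemidef
  have hv := linearIndependent_of_gram_posDef hK
  have diag_pos (k : ℕ) : 0 < (Matrix.gram ℂ v k k).re :=
    (Complex.pos_iff.1 (hK.diag_pos (i := k))).1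
  have hγ := isParameterFamily_reflectionFamily hv
  have hΘ := isSpectralFactor_factorArray v
  have isUnit := isUnit_arrayPhiSharp diag_pos hγ.norm_lt_one
  refine ⟨⟨_, hγ, fun γ hγ' => hγ'.unique diag_pos hγ⟩, ⟨_, hΘ, fun Θ hΘ' => hΘ'.unique hΘ⟩,
    fun γ hγ' => ?_⟩
  obtain rfl := hγ'.unique diag_pos hγ
  refine ⟨isOrthogonalFamily_orthPoly hv, isUnit,
    isSzegoClass_gram_iff.trans (hasPositiveProducts_gram_iff hv).symm, fun szego => ?_⟩
  have innovation_ne_zero := isSzegoClass_gram_iff.1 szego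
  refine ⟨convergesTo_arrayPhi hv innovation_ne_zero, fun Θ hΘ' => ?_⟩
  rw [hΘ'.unique hΘ]
  exact convergesTo_inverse_arrayPhiSharp hv innovation_ne_zero isUnit

theorem theorem3p3 (φ : NCPoly →ₗ[ℂ] ℂ) (hφ : IsStrictlyPositiveFunctional φ) :
    (∃! γ : ℕ → ℕ → ℂ, IsParameterFamily (momentKernel φ) γ) ∧
    ∀ γ : ℕ → ℕ → ℂ, IsParameterFamily (momentKernel φ) γ →
      (∀ l, IsOrthogonalFamily (shiftKernel (momentKernel φ) l)
        (fun n => orthPoly (momentKernel φ) γ n l)) ∧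
      (IsSzegoClass (momentKernel φ) ↔ HasPositiveProducts (momentKernel φ) γ) ∧
      (IsSzegoClass (momentKernel φ) →
        ConvergesTo (arrayPhi (momentKernel φ) γ) 0 ∧
        (∀ n, IsUnit (arrayPhiSharp (momentKernel φ) γ n)) ∧
        (∃! Θ : LowerArray, IsSpectralFactor (momentKernel φ) Θ) ∧
        ∀ Θ : LowerArray, IsSpectralFactor (momentKernel φ) Θ →
          ConvergesTo (fun n => Ring.inverse (arrayPhiSharp (momentKernel φ) γ n)) Θ) := by
  obtain ⟨parameters, factor, general⟩ := theorem3p3_general (momentKernel_posDef hφ)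
  exact ⟨parameters, fun γ hγ =>
    have ⟨orthogonal, isUnit, szego_iff, limits⟩ := general γ hγ
    ⟨orthogonal, szego_iff, fun szego => ⟨(limits szego).1, isUnit, factor, (limits szego).2⟩⟩⟩
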